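/- Let $T>0$. Let $A=(A_t)_{0\le t\le T}$ and $M=(M_t)_{0\le t\le T}$ be independent processes on a filtered probability space, where $A$ is adapted with paths of finite variation and $M$ is a martingale with $\mathbb E[M_0]=0$. Let $(A^m)_{m\in\mathbb N}$, $(M^m)_{m\in\mathbb N}$ be mutually independent copies of $A$ and $M$ on a probability space $(\Omega,\mathcal F,\mathbb P)$, the paths of $M^m$ being a.s. in $L^2([0,T])$. Let $\lambda^\star\in\mathbb R$, $G^\star\in L^2([0,T],\mathbb R)$, and let $u^e\in H^1([0,T],\mathbb R)$ with $u^e(0)\neq0$, where $H^1([a,b],\mathbb R)$ denotes the absolutely continuous functions on $[a,b]$ whose derivative lies in $L^2$. For $f\in L^2([0,T])$ put $(\boldsymbol u^e f)(t)=\int_0^t u^e(t-s)f(s)\,ds$. The observed prices are $$S^m_t=A^m_t+M^m_t-\lambda^\star u^e(t)-\int_0^t G^\star(t-s)u^e(s)\,ds,\qquad t\in[0,T].$$ Given weights $\tau_N>0$ and partitions $\pi_N=\{0=t_0<\dots<t_N=T\}$ with mesh size $|\pi_N|=\max_i(t_{i+1}-t_i)$, let $V_N$ be the space of functions $f$ on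 $[0,T]$ with $f(t)=\sum_{i=0}^{N-1}f(t_i)\mathbf 1_{[t_i,t_{i+1})}(t)$ for all $t\in[0,T]$, and define the estimators $$\lambda^N=-\frac1{Nu^e(0)}\sum_{m=1}^N(S^m_0-A^m_0),\qquad G^N=\operatorname*{arg\,min}_{G\in V_N}\Big(\frac1N\sum_{m=1}^N\|S^m-A^m+\lambda^Nu^e+\boldsymbol u^eG\|_{L^2([0,T])}^2+\tau_N\|G\|_{L^2([0,T])}^2\Big).$$ Assume that there is $C_M>0$ such that for all $N\ge1$ and $\eta>0$ $$\mathbb P\Big(\Big|\frac1N\sum_{m=1}^NM^m_0\Big|+\Big\|\frac1N\sum_{m=1}^NM^m\Big\|_{L^2([0,T])}\ge C_M\log(2\eta^{-1})N^{-1/2}\Big)\le\eta .$$ Write $r_N(\eta)=\dfrac{\log(\eta^{-1})+\log N}{\sqrt N}$, and let $C\ge1$. (1) Suppose $G^\star\in H^1([0,T],\mathbb R)$ and $G^\star(T)\neq0$. Then there is $C'>0$, independent of $\eta$, $N$ and of the choice of $(\tau_N,\pi_N)_N$, such that for all $\eta\in(0,1)$ and all $(\tau_N,\pi_N)_{N\ge2}$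 with $$\tfrac1C\,r_N(\eta)^{4/3}\le\tau_N\le C\,r_N(\eta)^{4/3},\qquad|\pi_N|\le C\tau_N^{1/2}\qquad\text{for all }N\ge2,$$ with probability at least $1-\eta$ it holds simultaneously for all $N\ge2$ that $G^N$ exists and $$|\lambda^N-\lambda^\star|\le C'r_N(\eta),\qquad\|G^N-G^\star\|_{L^2([0,T])}\le C'r_N(\eta)^{1/3}.$$ (2) Suppose that for some $\alpha\in(0,1/2)$, $t_0\in(0,T)$ and $C_0>0$, the function $G^\star$ is locally absolutely continuous on $(0,t_0]$ with $|\tfrac{d}{dt}G^\star(t)|\le C_0t^{-\alpha-1}$ for a.e. $t\in(0,t_0)$, and $G^\star\in H^1([t_0,T],\mathbb R)$. Then the conclusion of (1) holds with the exponent $4/3$ replaced by $\frac{4}{3-2\alpha}$ in the condition on $\tau_N$, and the exponent $1/3$ replaced by $\frac{1-2\alpha}{3-2\alpha}$ in the bound on $G^N$. -/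

import Mathlib

open MeasureTheory ProbabilityTheory Set

noncomputable section

namespace PropagatorEstimation

/-- The norm of `L²([0,T])`. -/
def l2norm (T : ℝ) (f : ℝ → ℝ) : ℝ :=
  (eLpNorm f 2 (volume.restrict (Icc 0 T))).toReal

/-- Membership in `H¹([a,b])`: absolutely continuous on `[a,b]` with a derivative in `L²`. -/
def MemH1 (a b : ℝ) (f : ℝ → ℝ) : Prop :=
  AbsolutelyContinuousOnInterval f a b ∧ MemLp (deriv f) 2 (volume.restrict (Icc a b))

/-- The random path `ω ↦ (X_t(ω))_{t ∈ [0,T]}` of a process. -/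
def path {Ω : Type*} (T : ℝ) (X : ℝ → Ω → ℝ) (ω : Ω) : Icc (0 : ℝ) T → ℝ :=
  fun t => X t ω

/-- The unaffected price `A + M` on `[0,T]`: an adapted signal `A` with paths of finite variation
and a martingale `M` independent of `A` with `E[M_0] = 0`. -/
structure IsUnaffectedPrice {Ω : Type*} [MeasurableSpace Ω] (T : ℝ) (P : Measure Ω)
    (ℱ : Filtration (Icc (0 : ℝ) T) ‹MeasurableSpace Ω›) (A M : ℝ → Ω → ℝ) : Prop where
  adapted_signal : StronglyAdapted ℱ (fun t : Icc (0 : ℝ) T => A t)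
  finite_variation : ∀ᵐ ω ∂P, BoundedVariationOn (fun t => A t ω) (Icc 0 T)
  martingale : Martingale (fun t : Icc (0 : ℝ) T => M t) ℱ P
  mean_zero : ∫ ω, M 0 ω ∂P = 0
  indep : IndepFun (path T A) (path T M) P

/-- `(A^m)` and `(M^m)` are mutually independent copies of `A₀` and `M₀`; the paths of the noise
are square integrable in time (automatic for càdlàg paths), so that their `L²([0,T])` norms make
sense. The copies are numbered from `0`. -/
structure AreIndependentCopies {Ω₀ Ω : Type*} [MeasurableSpace Ω₀] [MeasurableSpace Ω] (T : ℝ)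
    (P₀ : Measure Ω₀) (A₀ M₀ : ℝ → Ω₀ → ℝ) (P : Measure Ω) (A M : ℕ → ℝ → Ω → ℝ) : Prop where
  identDistrib_signal : ∀ m, IdentDistrib (path T (A m)) (path T A₀) P P₀
  identDistrib_noise : ∀ m, IdentDistrib (path T (M m)) (path T M₀) P P₀
  indep : iIndepFun (Sum.elim (fun m => path T (A m)) (fun m => path T (M m))) P
  memLp_noise : ∀ m, ∀ᵐ ω ∂P, MemLp (fun t => M m t ω) 2 (volume.restrict (Icc 0 T))

/-- The concentration condition on the empirical means of the noise. -/
def NoiseConcentration {Ω : Type*} [MeasurableSpace Ω] (T : ℝ) (P : Measure Ω)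
    (M : ℕ → ℝ → Ω → ℝ) : Prop :=
  ∃ CM : ℝ, 0 < CM ∧ ∀ N : ℕ, 1 ≤ N → ∀ η : ℝ, 0 < η →
    P.real {ω | CM * Real.log (2 * η⁻¹) * (N : ℝ) ^ (-(1 / 2) : ℝ) ≤
      |(1 / (N : ℝ)) * ∑ m ∈ Finset.range N, M m 0 ω| +
        l2norm T (fun t => (1 / (N : ℝ)) * ∑ m ∈ Finset.range N, M m t ω)} ≤ η

/-- The regular kernels. -/
def IsRegularKernel (T : ℝ) (G : ℝ → ℝ) : Prop :=
  MemH1 0 T G ∧ G T ≠ 0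

/-- The power-type singular kernels with exponent `α`. The bound on the derivative is one on the
weak derivative: `G` is locally absolutely continuous on `(0, t₀]`. -/
def IsSingularKernel (T α : ℝ) (G : ℝ → ℝ) : Prop :=
  ∃ t₀ ∈ Ioo 0 T, ∃ C₀ : ℝ, 0 < C₀ ∧
    (∀ ε ∈ Ioo 0 t₀, AbsolutelyContinuousOnInterval G ε t₀) ∧
    (∀ᵐ t ∂(volume.restrict (Ioo 0 t₀)), |deriv G t| ≤ C₀ * t ^ (-α - 1)) ∧
    MemH1 t₀ T G

/-- The Volterra operator `f ↦ ∫₀ᵗ u(t-s) f(s) ds`. -/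
def volterra (u f : ℝ → ℝ) (t : ℝ) : ℝ :=
  ∫ s in (0 : ℝ)..t, u (t - s) * f s

/-- The price `S_t = A_t + M_t - λ u(t) - ∫₀ᵗ G(t-s) u(s) ds` observed under the strategy `u`,
for given paths `a`, `m` of the signal and of the noise. -/
def observedPrice (lam : ℝ) (G u a m : ℝ → ℝ) (t : ℝ) : ℝ :=
  a t + m t - lam * u t - ∫ s in (0 : ℝ)..t, G (t - s) * u s

/-- The estimator `λ^N` computed from the first `N` observed paths of price and signal. -/
def lambdaLSE (u : ℝ → ℝ) (S A : ℕ → ℝ → ℝ) (N : ℕ) : ℝ :=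
  -(1 / ((N : ℝ) * u 0)) * ∑ m ∈ Finset.range N, (S m 0 - A m 0)

/-- `0 = t_0 < ⋯ < t_N = T`. -/
def IsPartition (T : ℝ) {N : ℕ} (π : Fin (N + 1) → ℝ) : Prop :=
  StrictMono π ∧ π 0 = 0 ∧ π (Fin.last N) = T

/-- The mesh size of a partition. -/
def mesh {N : ℕ} (π : Fin (N + 1) → ℝ) : ℝ :=
  ⨆ i : Fin N, (π i.succ - π i.castSucc)

/-- The piecewise constant functions on a partition. -/
def piecewiseConst (T : ℝ) {N : ℕ} (π : Fin (N + 1) → ℝ) : Set (ℝ → ℝ) :=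
  {f | ∀ t ∈ Icc 0 T,
    f t = ∑ i : Fin N, (Ico (π i.castSucc) (π i.succ)).indicator (fun _ => f (π i.castSucc)) t}

/-- The regularised empirical least-squares functional. -/
def lseLoss (T : ℝ) (u : ℝ → ℝ) (S A : ℕ → ℝ → ℝ) (N : ℕ) (τ : ℝ) (G : ℝ → ℝ) : ℝ :=
  (1 / (N : ℝ)) * ∑ m ∈ Finset.range N,
      l2norm T (fun t => S m t - A m t + lambdaLSE u S A N * u t + volterra u G t) ^ 2
    + τ * l2norm T G ^ 2

/-- `G` is a minimiser of the functional over the piecewise constant functions on `π`, that is,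
the kernel estimator `G^N`. -/
def IsKernelLSE (T : ℝ) (u : ℝ → ℝ) (S A : ℕ → ℝ → ℝ) {N : ℕ} (τ : ℝ) (π : Fin (N + 1) → ℝ)
    (G : ℝ → ℝ) : Prop :=
  G ∈ piecewiseConst T π ∧ IsMinOn (lseLoss T u S A N τ) (piecewiseConst T π) G

/-- `(log η⁻¹ + log N) / √N`. -/
def rate (η : ℝ) (N : ℕ) : ℝ :=
  (Real.log η⁻¹ + Real.log N) / √(N : ℝ)

/-- The choice of weights `τ_N` and partitions `π_N`, `N ≥ 2`, with exponent `p`. -/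
def IsTuned (T C η p : ℝ) (τ : ℕ → ℝ) (π : (N : ℕ) → Fin (N + 1) → ℝ) : Prop :=
  ∀ N : ℕ, 2 ≤ N →
    (1 / C) * rate η N ^ p ≤ τ N ∧ τ N ≤ C * rate η N ^ p ∧
    IsPartition T (π N) ∧ mesh (π N) ≤ C * √(τ N)

/-- There is `C' > 0` such that for all `η ∈ (0,1)` and all tunings with exponent `p`, with
probability at least `1 - η`, for all `N ≥ 2` the estimator `(λ^N, G^N)` is well defined and has
errors at most `C' * rate` and `C' * rate ^ q`. -/
def HighProbabilityBound {Ω : Type*} [MeasurableSpace Ω] (T : ℝ) (P : Measure Ω)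
    (A M : ℕ → ℝ → Ω → ℝ) (u : ℝ → ℝ) (lam : ℝ) (G : ℝ → ℝ) (C p q : ℝ) : Prop :=
  ∃ C' : ℝ, 0 < C' ∧ ∀ η ∈ Ioo (0 : ℝ) 1,
    ∀ (τ : ℕ → ℝ) (π : (N : ℕ) → Fin (N + 1) → ℝ), IsTuned T C η p τ π →
      ∃ E : Set Ω, MeasurableSet E ∧ 1 - η ≤ P.real E ∧ ∀ ω ∈ E, ∀ N : ℕ, 2 ≤ N →
        let a : ℕ → ℝ → ℝ := fun m t => A m t ω
        let S : ℕ → ℝ → ℝ := fun m => observedPrice lam G u (a m) (fun t => M m t ω)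
        |lambdaLSE u S a N - lam| ≤ C' * rate η N ∧
        (∃ GN, IsKernelLSE T u S a (τ N) (π N) GN) ∧
        ∀ GN, IsKernelLSE T u S a (τ N) (π N) GN →
          l2norm T (fun t => GN t - G t) ≤ C' * rate η N ^ q

end PropagatorEstimation

end

noncomputable section

namespace PropagatorEstimation

/-! ### Square integrable functions on an interval -/

/-! Since `u 0 ≠ 0` and `u` is in `H¹`, the Volterra operator K of `u` is as smoothing as
integration J from 0: integration by parts gives K f = u(0) J f + u' * J f, so the norms of K f and
J f are equivalent, one direction by Grönwall (`exists_norm_equiv`). The estimator is then a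
regularised Galerkin solution of an inverse problem of order one. Its data enter only through the
empirical mean of the noise and the error of λ^N, and the latter is a noise mean at time 0 divided
by `u 0`.

The deterministic core is `galerkin_error_le`. Let h satisfy |⟨h, f⟩| ≤ R ‖J f‖, and let d be the
distance from the true kernel to h. Testing the normal equations with the difference between the
estimator and the projection of the kernel onto the step functions bounds the error, when the mesh
is O(√τ), by a multiple of d + √τ R + noise/√τ. The projection costs little, since J is of the size
of the mesh on the orthogonal complement of the step functions.

A suitable h is J* k, the integral of k from t to T, with R = ‖k‖. Such a function vanishes at T,
while the kernel need not, and a singular kernel has no square integrable derivative near 0.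
Therefore the kernel is frozen on [0, δ] and cut off linearly on [T - δ, T]
(`exists_source_approx`). This costs d = O(δ^(1/2 - α)) and R = O(δ^(-1/2 - α)), with α = 0 for
regular kernels. With δ = √τ the bias is √τ^(1/2 - α), and balancing it against r/√τ gives the
exponents of the theorem (`balanced_rate_le`).

Probability enters only through a union bound over N with failure probabilities η/((N - 1)N), whose
logarithms are absorbed by log N (`exists_noise_event`). On the resulting event the argument is
pathwise. -/

theorem sq_integral_mul_le {X : Type*} [MeasurableSpace X] {μ : Measure X} {f g : X → ℝ}
    (hf : MemLp f 2 μ) (hg : MemLp g 2 μ) :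
    (∫ x, f x * g x ∂μ) ^ 2 ≤ (∫ x, f x ^ 2 ∂μ) * ∫ x, g x ^ 2 ∂μ := by
  have key : ∀ {p q : X → ℝ} (hp : MemLp p 2 μ) (hq : MemLp q 2 μ),
      inner ℝ (hp.toLp p) (hq.toLp q) = ∫ x, p x * q x ∂μ := by
    intro p q hp hq
    rw [L2.inner_def]
    refine integral_congr_ae ?_
    filter_upwards [hp.coeFn_toLp, hq.coeFn_toLp] with x h1 h2
    simp [h1, h2, mul_comm]
  have h := real_inner_mul_inner_self_le (hf.toLp f) (hg.toLp g)
  rw [key, key, key] at h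
  simpa only [sq] using h

theorem sq_intervalIntegral_mul_le {f g : ℝ → ℝ} {a b : ℝ} (hab : a ≤ b)
    (hf : MemLp f 2 (volume.restrict (Icc a b))) (hg : MemLp g 2 (volume.restrict (Icc a b))) :
    (∫ x in a..b, f x * g x) ^ 2 ≤ (∫ x in a..b, f x ^ 2) * ∫ x in a..b, g x ^ 2 := by
  simp only [intervalIntegral.integral_of_le hab, ← integral_Icc_eq_integral_Ioc]
  exact sq_integral_mul_le hf hg

theorem memLp_mono_Icc {f : ℝ → ℝ} {a b c d : ℝ} {p : ENNReal}
    (hf : MemLp f p (volume.restrict (Icc a b))) (hac : a ≤ c) (hdb : d ≤ b) :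
    MemLp f p (volume.restrict (Icc c d)) :=
  hf.mono_measure (Measure.restrict_mono (Icc_subset_Icc hac hdb) le_rfl)

theorem memLp_intervalIntegrable {f : ℝ → ℝ} {a b : ℝ} (hab : a ≤ b)
    (hf : MemLp f 2 (volume.restrict (Icc a b))) : IntervalIntegrable f volume a b := by
  rw [intervalIntegrable_iff_integrableOn_Icc_of_le hab]
  exact hf.integrable one_le_two

theorem memLp_intervalIntegrable_sq {f : ℝ → ℝ} {a b : ℝ} (hab : a ≤ b)
    (hf : MemLp f 2 (volume.restrict (Icc a b))) :
    IntervalIntegrable (fun x => f x ^ 2) volume a b := by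
  rw [intervalIntegrable_iff_integrableOn_Icc_of_le hab]
  exact hf.integrable_sq

theorem continuousOn_memLp {f : ℝ → ℝ} {a b : ℝ} (hf : ContinuousOn f (Icc a b)) {p : ENNReal} :
    MemLp f p (volume.restrict (Icc a b)) := by
  obtain ⟨B, hB⟩ := isCompact_Icc.exists_bound_of_continuousOn hf
  refine MemLp.of_bound (hf.aestronglyMeasurable measurableSet_Icc) B ?_
  exact (ae_restrict_iff' measurableSet_Icc).2 (ae_of_all _ hB)

theorem sq_integral_le {f : ℝ → ℝ} {a b : ℝ} (hab : a ≤ b)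
    (hf : MemLp f 2 (volume.restrict (Icc a b))) :
    (∫ x in a..b, f x) ^ 2 ≤ (b - a) * ∫ x in a..b, f x ^ 2 := by
  have h := sq_intervalIntegral_mul_le hab
    (continuousOn_memLp (f := fun _ => (1 : ℝ)) continuousOn_const) hf
  simpa using h

/-- Integration by parts for two primitives. -/
theorem integral_primitive_mul {k f : ℝ → ℝ} {a b : ℝ}
    (hk : IntervalIntegrable k volume a b) (hf : IntervalIntegrable f volume a b) :
    ∫ s in a..b, (∫ r in s..b, k r) * f s = ∫ s in a..b, k s * ∫ r in a..s, f r := by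
  -- One primitive is based at `b`, the other at `a`, so that the boundary terms vanish at both
  -- ends.
  have hK := hk.absolutelyContinuousOnInterval_intervalIntegral (c := b) (by simp)
  have hF := hf.absolutelyContinuousOnInterval_intervalIntegral (c := a) (by simp)
  have h := hK.integral_mul_deriv_eq_deriv_mul hF
  have e1 : ∫ x in a..b, (∫ v in b..x, k v) * deriv (fun x => ∫ v in a..x, f v) x
      = ∫ x in a..b, (∫ v in b..x, k v) * f x := by
    refine intervalIntegral.integral_congr_ae ?_
    filter_upwards [hf.ae_hasDerivAt_integral] with x hx hxm
    rw [(hx (uIoc_subset_uIcc hxm) a (by simp)).deriv]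
  have e2 : ∫ x in a..b, deriv (fun x => ∫ v in b..x, k v) x * ∫ v in a..x, f v
      = ∫ x in a..b, k x * ∫ v in a..x, f v := by
    refine intervalIntegral.integral_congr_ae ?_
    filter_upwards [hk.ae_hasDerivAt_integral] with x hx hxm
    rw [(hx (uIoc_subset_uIcc hxm) b (by simp)).deriv]
  rw [e1, e2] at h
  simp only [intervalIntegral.integral_same, zero_mul, mul_zero, sub_zero, zero_sub] at h
  rw [← neg_eq_iff_eq_neg, ← intervalIntegral.integral_neg] at h
  rw [← h]
  refine intervalIntegral.integral_congr fun s _ => ?_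
  rw [intervalIntegral.integral_symm s b, neg_mul, neg_neg]

/-! ### The Volterra operator -/

theorem continuousOn_primitive_of_memLp {f : ℝ → ℝ} {T : ℝ} (hT : 0 ≤ T)
    (hf : MemLp f 2 (volume.restrict (Icc 0 T))) :
    ContinuousOn (fun t => ∫ s in (0 : ℝ)..t, f s) (Icc 0 T) := by
  have h := ((memLp_intervalIntegrable hT hf).absolutelyContinuousOnInterval_intervalIntegral
    (c := 0) (by simp)).continuousOn
  rwa [uIcc_of_le hT] at h

theorem memLp_reflect {v : ℝ → ℝ} {t : ℝ} {p : ENNReal}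
    (hv : MemLp v p (volume.restrict (Icc 0 t))) :
    MemLp (fun s => v (t - s)) p (volume.restrict (Icc 0 t)) := by
  have h := (Measure.measurePreserving_sub_left (volume : Measure ℝ) t).restrict_preimage
    (measurableSet_Icc (a := (0 : ℝ)) (b := t))
  have e : (fun x => t - x) ⁻¹' Icc (0 : ℝ) t = Icc 0 t := by
    ext x; simp only [mem_preimage, mem_Icc]; constructor <;> rintro ⟨h1, h2⟩ <;> constructor <;>
      linarith
  rw [e] at h
  exact hv.comp_measurePreserving h

theorem volterra_congr {u f g : ℝ → ℝ} {T t : ℝ} (ht : t ∈ Icc 0 T)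
    (h : f =ᵐ[volume.restrict (Icc 0 T)] g) : volterra u f t = volterra u g t := by
  refine intervalIntegral.integral_congr_ae ?_
  filter_upwards [(ae_restrict_iff' measurableSet_Icc).1 h] with s hs hst
  rw [uIoc_of_le ht.1] at hst
  rw [hs ⟨hst.1.le, hst.2.trans ht.2⟩]

theorem volterra_one (f : ℝ → ℝ) (t : ℝ) :
    volterra (fun _ => 1) f t = ∫ s in (0 : ℝ)..t, f s := by
  simp [volterra]

theorem volterra_intervalIntegrable {u f : ℝ → ℝ} {T t : ℝ} (ht : t ∈ Icc 0 T)
    (hu : ContinuousOn u (Icc 0 T)) (hf : MemLp f 2 (volume.restrict (Icc 0 T))) :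
    IntervalIntegrable (fun s => u (t - s) * f s) volume 0 t := by
  refine (memLp_intervalIntegrable ht.1 (memLp_mono_Icc hf le_rfl ht.2)).continuousOn_mul ?_
  rw [uIcc_of_le ht.1]
  refine hu.comp (by fun_prop) fun s hs => ?_
  exact ⟨by linarith [hs.2], by linarith [hs.1, ht.2]⟩

theorem integral_comm_volterra (u G : ℝ → ℝ) (t : ℝ) :
    ∫ s in (0 : ℝ)..t, G (t - s) * u s = volterra u G t := by
  have h := intervalIntegral.integral_comp_sub_left (a := 0) (b := t)
    (fun s => G (t - s) * u s) t
  simp only [sub_sub_cancel, sub_self, sub_zero] at h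
  rw [← h, volterra]
  simp only [mul_comm]

theorem memH1_continuousOn {u : ℝ → ℝ} {a b : ℝ} (hab : a ≤ b) (hu : MemH1 a b u) :
    ContinuousOn u (Icc a b) := by
  have := hu.1.continuousOn
  rwa [uIcc_of_le hab] at this

/-- The Volterra operator of an `H¹` function in terms of the primitive. -/
theorem volterra_eq_primitive {u f : ℝ → ℝ} {T t : ℝ} (hu : MemH1 0 T u) (ht : t ∈ Icc 0 T)
    (hf : MemLp f 2 (volume.restrict (Icc 0 T))) :
    volterra u f t = u 0 * (∫ s in (0 : ℝ)..t, f s)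
      + ∫ s in (0 : ℝ)..t, deriv u (t - s) * ∫ r in (0 : ℝ)..s, f r := by
  have hf' := memLp_intervalIntegrable ht.1 (memLp_mono_Icc hf le_rfl ht.2)
  have hk := memLp_intervalIntegrable ht.1
    (memLp_reflect (memLp_mono_Icc hu.2 (le_refl (0 : ℝ)) ht.2))
  have hT : 0 ≤ T := ht.1.trans ht.2
  -- Moving the primitive back onto `deriv u` reduces the claim to u(t - s) = u(0) + ∫ₛᵗ u'(t - r)
  -- dr under the integral.
  rw [← integral_primitive_mul hk hf', ← intervalIntegral.integral_const_mul,
    ← intervalIntegral.integral_add (hf'.const_mul _)]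
  · refine intervalIntegral.integral_congr fun s hs => ?_
    rw [uIcc_of_le ht.1] at hs
    rw [intervalIntegral.integral_comp_sub_left (deriv u) t, sub_self,
      (hu.1.mono _).integral_deriv_eq_sub]
    · ring
    · rw [uIcc_of_le hT, uIcc_of_le (by linarith [hs.2])]
      exact Icc_subset_Icc le_rfl (by linarith [hs.1, ht.2])
  · refine hf'.continuousOn_mul ?_
    have := (hk.absolutelyContinuousOnInterval_intervalIntegral (c := t) (by simp)).continuousOn.neg
    refine this.congr fun s _ => ?_
    rw [intervalIntegral.integral_symm]
    rfl

/-- The bound is sup |u| times the L¹ norm of `f`. Measurability in `t` comes from Fubini, for which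
`u` is extended continuously to the line and `f` is replaced by a strongly measurable version, so
that the integrand is jointly measurable. -/
theorem volterra_memLp {u f : ℝ → ℝ} {T : ℝ} (hT : 0 ≤ T) (hu : ContinuousOn u (Icc 0 T))
    (hf : MemLp f 2 (volume.restrict (Icc 0 T))) :
    MemLp (volterra u f) 2 (volume.restrict (Icc 0 T)) := by
  obtain ⟨B, hB⟩ := isCompact_Icc.exists_bound_of_continuousOn hu
  set v : ℝ → ℝ := IccExtend hT ((Icc 0 T).domRestrict u) with hv
  have hvc : Continuous v := (continuousOn_iff_continuous_domRestrict.1 hu).Icc_extend'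
  set g := hf.1.mk f with hg
  have hgm : StronglyMeasurable g := hf.1.stronglyMeasurable_mk
  have hfg : f =ᵐ[volume.restrict (Icc 0 T)] g := hf.1.ae_eq_mk
  have hmeas : StronglyMeasurable fun t : ℝ =>
      ∫ s, ({p : ℝ × ℝ | 0 < p.2 ∧ p.2 ≤ p.1}.indicator
        (fun p => v (p.1 - p.2) * g p.2) (t, s)) := by
    refine StronglyMeasurable.integral_prod_right' (StronglyMeasurable.indicator ?_ ?_)
    · exact (hvc.comp (by fun_prop)).stronglyMeasurable.mul
        (hgm.comp_measurable measurable_snd)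
    · exact (measurableSet_lt measurable_const measurable_snd).inter
        (measurableSet_le measurable_snd measurable_fst)
  have heq : ∀ t ∈ Icc 0 T, volterra u f t = ∫ s, ({p : ℝ × ℝ | 0 < p.2 ∧ p.2 ≤ p.1}.indicator
        (fun p => v (p.1 - p.2) * g p.2) (t, s)) := by
    intro t ht
    rw [volterra_congr ht hfg, volterra, intervalIntegral.integral_of_le ht.1,
      ← integral_indicator measurableSet_Ioc]
    refine integral_congr_ae (ae_of_all _ fun s => ?_)
    by_cases hs : 0 < s ∧ s ≤ t
    · have e : v (t - s) = u (t - s) := by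
        rw [hv, IccExtend_of_mem hT _ ⟨by linarith [hs.2], by linarith [hs.1, ht.2]⟩]; rfl
      simp [indicator, hs, e]
    · simp [indicator, hs]
  refine MemLp.of_bound (C := B * ∫ s in (0 : ℝ)..T, |f s|) ?_ ?_
  · refine hmeas.aestronglyMeasurable.congr ?_
    exact (ae_restrict_iff' measurableSet_Icc).2 (ae_of_all _ fun t ht => (heq t ht).symm)
  · refine (ae_restrict_iff' measurableSet_Icc).2 (ae_of_all _ fun t ht => ?_)
    have hintg := (memLp_intervalIntegrable hT hf).abs
    have hB0 : 0 ≤ B := (norm_nonneg _).trans (hB 0 ⟨le_rfl, hT⟩)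
    have hintg' : IntervalIntegrable (fun s => |f s|) volume 0 t :=
      (memLp_intervalIntegrable ht.1 (memLp_mono_Icc hf le_rfl ht.2)).abs
    calc ‖volterra u f t‖ ≤ ∫ s in (0 : ℝ)..t, B * |f s| := by
          refine intervalIntegral.norm_integral_le_of_norm_le ht.1 (ae_of_all _ fun s hs => ?_)
            (hintg'.const_mul B)
          rw [norm_mul]
          exact mul_le_mul_of_nonneg_right
            (hB _ ⟨by linarith [hs.2], by linarith [hs.1, ht.2]⟩) (abs_nonneg _)
      _ = B * ∫ s in (0 : ℝ)..t, |f s| := intervalIntegral.integral_const_mul _ _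
      _ ≤ B * ∫ s in (0 : ℝ)..T, |f s| := by
          refine mul_le_mul_of_nonneg_left ?_ hB0
          exact intervalIntegral.integral_mono_interval le_rfl ht.1 ht.2
            (ae_of_all _ fun s => abs_nonneg _) hintg

/-- Cauchy–Schwarz after reflecting `v`. The integral of `E ^ 2` is kept up to `t` only, as
Grönwall's inequality requires. -/
theorem sq_convolution_le {v E : ℝ → ℝ} {T t : ℝ} (ht : t ∈ Icc 0 T)
    (hv : MemLp v 2 (volume.restrict (Icc 0 T))) (hE : ContinuousOn E (Icc 0 T)) :
    (∫ s in (0 : ℝ)..t, v (t - s) * E s) ^ 2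
      ≤ (∫ s in (0 : ℝ)..T, v s ^ 2) * ∫ s in (0 : ℝ)..t, E s ^ 2 := by
  have hE' : ContinuousOn E (Icc 0 t) := hE.mono (Icc_subset_Icc le_rfl ht.2)
  refine (sq_intervalIntegral_mul_le ht.1 (memLp_reflect (memLp_mono_Icc hv le_rfl ht.2))
    (continuousOn_memLp hE')).trans (mul_le_mul_of_nonneg_right ?_
      (intervalIntegral.integral_nonneg ht.1 fun s _ => sq_nonneg _))
  rw [intervalIntegral.integral_comp_sub_left (fun s => v s ^ 2) t, sub_self, sub_zero]
  exact intervalIntegral.integral_mono_interval le_rfl ht.1 ht.2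
    (ae_of_all _ fun s => sq_nonneg _)
    (memLp_intervalIntegrable_sq (ht.1.trans ht.2) hv)

/-- The Volterra operator of an `H¹` function is bounded by the primitive. -/
theorem integral_sq_volterra_le {u : ℝ → ℝ} {T : ℝ} (hT : 0 ≤ T) (hu : MemH1 0 T u) :
    ∃ c : ℝ, 0 ≤ c ∧ ∀ f : ℝ → ℝ, MemLp f 2 (volume.restrict (Icc 0 T)) →
      ∫ t in (0 : ℝ)..T, volterra u f t ^ 2
        ≤ c * ∫ t in (0 : ℝ)..T, (∫ s in (0 : ℝ)..t, f s) ^ 2 := by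
  set D := ∫ s in (0 : ℝ)..T, deriv u s ^ 2 with hD
  have hD0 : 0 ≤ D := intervalIntegral.integral_nonneg hT fun s _ => sq_nonneg _
  -- From (x + y)² ≤ 2x² + 2y² applied to u(0) E + u' * E; the factor `T` comes from integrating the
  -- uniform bound on the convolution.
  refine ⟨2 * u 0 ^ 2 + 2 * D * T, by positivity, fun f hf => ?_⟩
  set E : ℝ → ℝ := fun t => ∫ s in (0 : ℝ)..t, f s with hE
  have hEc : ContinuousOn E (Icc 0 T) := continuousOn_primitive_of_memLp hT hf
  have hEi : IntervalIntegrable (fun t => E t ^ 2) volume 0 T :=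
    memLp_intervalIntegrable_sq hT (continuousOn_memLp hEc)
  set F := ∫ t in (0 : ℝ)..T, E t ^ 2 with hF
  have hpt : ∀ t ∈ Icc 0 T, volterra u f t ^ 2 ≤ 2 * u 0 ^ 2 * E t ^ 2 + 2 * D * F := by
    intro t ht
    have h1 := sq_convolution_le ht hu.2 hEc
    have h2 : ∫ s in (0 : ℝ)..t, E s ^ 2 ≤ F :=
      intervalIntegral.integral_mono_interval le_rfl ht.1 ht.2 (ae_of_all _ fun s => sq_nonneg _)
        hEi
    have h3 : D * (∫ s in (0 : ℝ)..t, E s ^ 2) ≤ D * F := mul_le_mul_of_nonneg_left h2 hD0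
    rw [volterra_eq_primitive hu ht hf]
    have h4 := add_sq_le (a := u 0 * E t) (b := ∫ s in (0 : ℝ)..t, deriv u (t - s) * E s)
    simp only [mul_pow] at h4
    linarith
  calc ∫ t in (0 : ℝ)..T, volterra u f t ^ 2
      ≤ ∫ t in (0 : ℝ)..T, (2 * u 0 ^ 2 * E t ^ 2 + 2 * D * F) :=
        intervalIntegral.integral_mono_on hT
          (memLp_intervalIntegrable_sq hT (volterra_memLp hT (memH1_continuousOn hT hu) hf))
          ((hEi.const_mul _).add intervalIntegrable_const) hpt
    _ = (2 * u 0 ^ 2 + 2 * D * T) * F := by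
        rw [intervalIntegral.integral_add (hEi.const_mul _) intervalIntegrable_const,
          intervalIntegral.integral_const_mul, intervalIntegral.integral_const, smul_eq_mul]
        ring

/-- A Grönwall inequality in integral form. -/
theorem integral_le_of_le_add_primitive {φ a : ℝ → ℝ} {T c : ℝ} (hT : 0 ≤ T) (hc : 0 ≤ c)
    (hφ : ContinuousOn φ (Icc 0 T)) (ha : IntervalIntegrable a volume 0 T)
    (ha0 : ∀ t ∈ Icc 0 T, 0 ≤ a t)
    (h : ∀ t ∈ Icc 0 T, φ t ≤ a t + c * ∫ s in (0 : ℝ)..t, φ s) :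
    ∫ t in (0 : ℝ)..T, φ t ≤ Real.exp (c * T) * ∫ t in (0 : ℝ)..T, a t := by
  set F : ℝ → ℝ := fun t => ∫ s in (0 : ℝ)..t, φ s with hF
  have hφi : IntervalIntegrable φ volume 0 T := by
    rw [← uIcc_of_le hT] at hφ; exact hφ.intervalIntegrable
  have hFc : ContinuousOn F (Icc 0 T) :=
    continuousOn_primitive_of_memLp hT (continuousOn_memLp hφ)
  -- Integrating factor: F' = φ ≤ a + c F makes the derivative of exp(-ct) F at most exp(-ct) a,
  -- which is at most `a` because `a` is nonnegative.
  have hderiv : ∀ t ∈ Ioo 0 T, HasDerivAt (fun t => Real.exp (-c * t) * F t)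
      (Real.exp (-c * t) * (-c) * F t + Real.exp (-c * t) * φ t) t := by
    intro t ht
    have h1 : HasDerivAt (fun t => Real.exp (-c * t)) (Real.exp (-c * t) * (-c)) t := by
      simpa using ((hasDerivAt_id t).const_mul (-c)).exp
    have hnhds : Icc 0 T ∈ nhds t := Icc_mem_nhds ht.1 ht.2
    have h2 : HasDerivAt F (φ t) t := by
      refine intervalIntegral.integral_hasDerivAt_right (hφi.mono_set ?_) ?_ ?_
      · rw [uIcc_of_le hT, uIcc_of_le ht.1.le]; exact Icc_subset_Icc le_rfl ht.2.le
      · exact hφ.stronglyMeasurableAtFilter_nhdsWithin measurableSet_Icc t |>.filter_mono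
          (by rw [nhdsWithin_eq_nhds.2 hnhds])
      · exact hφ.continuousAt hnhds
    exact h1.mul h2
  have hexp : Continuous fun t : ℝ => Real.exp (-c * t) := by fun_prop
  have hintg : IntervalIntegrable
      (fun t => Real.exp (-c * t) * (-c) * F t + Real.exp (-c * t) * φ t) volume 0 T := by
    refine ContinuousOn.intervalIntegrable ?_
    rw [uIcc_of_le hT]
    exact ((hexp.continuousOn.mul continuousOn_const).mul hFc).add (hexp.continuousOn.mul hφ)
  have hftc := intervalIntegral.integral_eq_sub_of_hasDerivAt_of_le hT
    (hexp.continuousOn.mul hFc) hderiv hintg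
  have hF0 : F 0 = 0 := by simp [hF]
  have hle : ∫ t in (0 : ℝ)..T, (Real.exp (-c * t) * (-c) * F t + Real.exp (-c * t) * φ t)
      ≤ ∫ t in (0 : ℝ)..T, a t := by
    refine intervalIntegral.integral_mono_on hT hintg ha fun t ht => ?_
    have h1 : Real.exp (-c * t) ≤ 1 := Real.exp_le_one_iff.2 (by nlinarith [ht.1])
    have h2 := h t ht
    have h3 : Real.exp (-c * t) * (φ t - c * F t) ≤ Real.exp (-c * t) * a t :=
      mul_le_mul_of_nonneg_left (by linarith) (Real.exp_pos _).le
    have h4 : Real.exp (-c * t) * a t ≤ 1 * a t := mul_le_mul_of_nonneg_right h1 (ha0 t ht)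
    linarith
  simp only [hftc, Pi.mul_apply, hF0, mul_zero, sub_zero] at hle
  calc F T = Real.exp (c * T) * (Real.exp (-c * T) * F T) := by
        rw [← mul_assoc, ← Real.exp_add]; simp
    _ ≤ _ := mul_le_mul_of_nonneg_left hle (Real.exp_pos _).le

/-- The primitive is bounded by the Volterra operator of an `H¹` function not vanishing at `0`. -/
theorem integral_sq_primitive_le {u : ℝ → ℝ} {T : ℝ} (hT : 0 ≤ T) (hu : MemH1 0 T u)
    (hu0 : u 0 ≠ 0) :
    ∃ c : ℝ, 0 ≤ c ∧ ∀ f : ℝ → ℝ, MemLp f 2 (volume.restrict (Icc 0 T)) →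
      ∫ t in (0 : ℝ)..T, (∫ s in (0 : ℝ)..t, f s) ^ 2
        ≤ c * ∫ t in (0 : ℝ)..T, volterra u f t ^ 2 := by
  set D := ∫ s in (0 : ℝ)..T, deriv u s ^ 2 with hD
  have hD0 : 0 ≤ D := intervalIntegral.integral_nonneg hT fun s _ => sq_nonneg _
  have hu2 : 0 < u 0 ^ 2 := by positivity
  -- Solving for the primitive, u(0) E = K f - u' * E. Squaring gives E² ≤ (2/u(0)²) (K f)² +
  -- (2D/u(0)²) ∫₀ᵗ E², to which Grönwall applies.
  refine ⟨Real.exp (2 * D / u 0 ^ 2 * T) * (2 / u 0 ^ 2), by positivity, fun f hf => ?_⟩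
  set E : ℝ → ℝ := fun t => ∫ s in (0 : ℝ)..t, f s with hE
  have hEc : ContinuousOn E (Icc 0 T) := continuousOn_primitive_of_memLp hT hf
  have hKi := memLp_intervalIntegrable_sq hT (volterra_memLp hT (memH1_continuousOn hT hu) hf)
  rw [mul_assoc, ← intervalIntegral.integral_const_mul (2 / u 0 ^ 2) fun t => volterra u f t ^ 2]
  refine integral_le_of_le_add_primitive (φ := fun t => E t ^ 2)
    (a := fun t => 2 / u 0 ^ 2 * volterra u f t ^ 2) hT (by positivity) (hEc.pow 2)
    (hKi.const_mul _) (fun t _ => by positivity) fun t ht => ?_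
  have h1 := sq_convolution_le ht hu.2 hEc
  have h2 := volterra_eq_primitive hu ht hf
  have h3 := add_sq_le (a := volterra u f t)
    (b := -∫ s in (0 : ℝ)..t, deriv u (t - s) * E s)
  have h4 : u 0 * E t = volterra u f t + -∫ s in (0 : ℝ)..t, deriv u (t - s) * E s := by
    rw [h2]; ring
  rw [← h4, mul_pow, neg_sq] at h3
  have h5 : 2 / u 0 ^ 2 * volterra u f t ^ 2
      + 2 * D / u 0 ^ 2 * ∫ s in (0 : ℝ)..t, E s ^ 2
      = (2 * (volterra u f t ^ 2 + D * ∫ s in (0 : ℝ)..t, E s ^ 2)) / u 0 ^ 2 := by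
    field_simp
  change E t ^ 2 ≤ _
  rw [h5, le_div_iff₀ hu2]
  linarith

/-! ### Partitions -/

theorem mesh_nonneg {N : ℕ} {π : Fin (N + 1) → ℝ} (h : StrictMono π) : 0 ≤ mesh π :=
  Real.iSup_nonneg fun _ => sub_nonneg.2 (h.monotone (Fin.castSucc_lt_succ).le)

theorem sub_le_mesh {N : ℕ} (π : Fin (N + 1) → ℝ) (i : Fin N) :
    π i.succ - π i.castSucc ≤ mesh π :=
  le_ciSup (f := fun i : Fin N => π i.succ - π i.castSucc) (Set.finite_range _).bddAbove i

theorem IsPartition.mem_Icc {N : ℕ} {π : Fin (N + 1) → ℝ} {T : ℝ} (h : IsPartition T π)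
    (i : Fin (N + 1)) : π i ∈ Icc 0 T :=
  ⟨h.2.1 ▸ h.1.monotone (Fin.zero_le i), h.2.2 ▸ h.1.monotone (Fin.le_last i)⟩

theorem IsPartition.intervalIntegrable {N : ℕ} {π : Fin (N + 1) → ℝ} {T : ℝ}
    (h : IsPartition T π) {g : ℝ → ℝ} (hg : IntervalIntegrable g volume 0 T)
    (i j : Fin (N + 1)) : IntervalIntegrable g volume (π i) (π j) :=
  hg.mono_set (by
    have hT : 0 ≤ T := (h.mem_Icc 0).1.trans (h.mem_Icc 0).2
    rw [uIcc_of_le hT]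
    exact (convex_Icc 0 T).ordConnected.uIcc_subset (h.mem_Icc i) (h.mem_Icc j))

theorem sum_integral_partition {N : ℕ} {π : Fin (N + 1) → ℝ} {T : ℝ}
    (h : IsPartition T π) {g : ℝ → ℝ} (hg : IntervalIntegrable g volume 0 T) :
    ∑ i : Fin N, ∫ x in (π i.castSucc)..(π i.succ), g x = ∫ x in (0 : ℝ)..T, g x := by
  have hcell : ∀ i : Fin N, ∫ x in (π i.castSucc)..(π i.succ), g x
      = (∫ x in (π 0)..(π i.succ), g x) - ∫ x in (π 0)..(π i.castSucc), g x := fun i =>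
    (intervalIntegral.integral_interval_sub_left (h.intervalIntegrable hg _ _)
      (h.intervalIntegrable hg _ _)).symm
  have h1 := Fin.sum_univ_succ fun i => ∫ x in (π 0)..(π i), g x
  have h2 := Fin.sum_univ_castSucc fun i => ∫ x in (π 0)..(π i), g x
  rw [intervalIntegral.integral_same] at h1
  rw [Finset.sum_congr rfl fun i _ => hcell i, Finset.sum_sub_distrib]
  rw [h.2.1, h.2.2] at *
  linarith

theorem primitive_partition_eq_zero {N : ℕ} {π : Fin (N + 1) → ℝ} {T : ℝ}
    (h : IsPartition T π) {f : ℝ → ℝ} (hf : IntervalIntegrable f volume 0 T)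
    (h0 : ∀ i : Fin N, ∫ x in (π i.castSucc)..(π i.succ), f x = 0) (i : Fin (N + 1)) :
    ∫ x in (0 : ℝ)..(π i), f x = 0 := by
  have key : ∫ x in (π 0)..(π i), f x = 0 := by
    induction i using Fin.induction with
    | zero => simp
    | succ i ih =>
      rw [← intervalIntegral.integral_add_adjacent_intervals (b := π i.castSucc)
        (h.intervalIntegrable hf _ _) (h.intervalIntegrable hf _ _), ih, h0, add_zero]
  rwa [h.2.1] at key

/-- The primitive of a function with vanishing cell averages is small. -/
theorem integral_sq_primitive_le_mesh {N : ℕ} {π : Fin (N + 1) → ℝ} {T : ℝ}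
    (h : IsPartition T π) {f : ℝ → ℝ} (hf : MemLp f 2 (volume.restrict (Icc 0 T)))
    (h0 : ∀ i : Fin N, ∫ x in (π i.castSucc)..(π i.succ), f x = 0) :
    ∫ t in (0 : ℝ)..T, (∫ s in (0 : ℝ)..t, f s) ^ 2
      ≤ mesh π ^ 2 * ∫ t in (0 : ℝ)..T, f t ^ 2 := by
  have hT : 0 ≤ T := (h.mem_Icc 0).1.trans (h.mem_Icc 0).2
  have hm := mesh_nonneg h.1
  have hfi := memLp_intervalIntegrable hT hf
  have hfi2 := memLp_intervalIntegrable_sq hT hf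
  have hEi := memLp_intervalIntegrable_sq hT
    (continuousOn_memLp (p := 2) (continuousOn_primitive_of_memLp hT hf))
  rw [← sum_integral_partition h hEi, ← sum_integral_partition h hfi2, Finset.mul_sum]
  refine Finset.sum_le_sum fun i _ => ?_
  have hle : π i.castSucc ≤ π i.succ := h.1.monotone (Fin.castSucc_lt_succ).le
  set J := ∫ t in (π i.castSucc)..(π i.succ), f t ^ 2 with hJ
  have hJ0 : 0 ≤ J := intervalIntegral.integral_nonneg hle fun s _ => sq_nonneg _
  -- The primitive vanishes at every node, so on a cell only the part from the left endpoint counts.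
  -- Cauchy–Schwarz yields one factor `mesh π`; integrating over the cell yields the other.
  have hpt : ∀ t ∈ Icc (π i.castSucc) (π i.succ), (∫ s in (0 : ℝ)..t, f s) ^ 2 ≤ mesh π * J := by
    intro t ht
    have ht' : t ≤ T := ht.2.trans (h.mem_Icc _).2
    have hft : MemLp f 2 (volume.restrict (Icc (π i.castSucc) t)) :=
      memLp_mono_Icc hf (h.mem_Icc _).1 ht'
    rw [← intervalIntegral.integral_add_adjacent_intervals (b := π i.castSucc)
      (h.2.1 ▸ h.intervalIntegrable hfi 0 i.castSucc) (memLp_intervalIntegrable ht.1 hft),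
      primitive_partition_eq_zero h hfi h0, zero_add]
    refine (sq_integral_le ht.1 hft).trans ?_
    refine mul_le_mul ?_ ?_ (intervalIntegral.integral_nonneg ht.1 fun s _ => sq_nonneg _) hm
    · linarith [sub_le_mesh π i, ht.2]
    · exact intervalIntegral.integral_mono_interval le_rfl ht.1 ht.2
        (ae_of_all _ fun s => sq_nonneg _) (h.intervalIntegrable hfi2 _ _)
  calc ∫ t in (π i.castSucc)..(π i.succ), (∫ s in (0 : ℝ)..t, f s) ^ 2
      ≤ ∫ t in (π i.castSucc)..(π i.succ), mesh π * J :=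
        intervalIntegral.integral_mono_on hle (h.intervalIntegrable hEi _ _)
          intervalIntegrable_const hpt
    _ = (π i.succ - π i.castSucc) * (mesh π * J) := by
        rw [intervalIntegral.integral_const, smul_eq_mul]
    _ ≤ mesh π * (mesh π * J) :=
        mul_le_mul_of_nonneg_right (sub_le_mesh π i) (by positivity)
    _ = mesh π ^ 2 * J := by ring

/-! ### Regularised least squares in Hilbert spaces -/

section Hilbert

variable {H : Type*} [NormedAddCommGroup H] [InnerProductSpace ℝ H]

/-- The regularised least-squares functional with data `x 0, …, x (N - 1)`. -/
def ridge (K : H →ₗ[ℝ] H) (x : ℕ → H) (N : ℕ) (τ : ℝ) (v : H) : ℝ :=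
  (1 / (N : ℝ)) * ∑ m ∈ Finset.range N, ‖x m + K v‖ ^ 2 + τ * ‖v‖ ^ 2

/-- The penalty makes the functional coercive, and in finite dimension a continuous coercive
function attains its minimum. -/
theorem exists_isMinOn_ridge (K : H →ₗ[ℝ] H) (x : ℕ → H) (N : ℕ) {τ : ℝ} (hτ : 0 < τ)
    (V : Submodule ℝ H) [FiniteDimensional ℝ V] : ∃ g ∈ V, IsMinOn (ridge K x N τ) V g := by
  have : ProperSpace V := FiniteDimensional.proper ℝ V
  have hK : Continuous fun v : V => K v :=
    LinearMap.continuous_of_finiteDimensional (K ∘ₗ V.subtype)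
  have hc : Continuous fun v : V => ridge K x N τ v := by
    refine (continuous_const.mul (continuous_finsetSum _ fun m _ => ?_)).add
      (continuous_const.mul (continuous_subtype_val.norm.pow 2))
    exact (continuous_const.add hK).norm.pow 2
  have hlim : Filter.Tendsto (fun v : V => ridge K x N τ v) (Filter.cocompact V)
      Filter.atTop := by
    refine Filter.tendsto_atTop_mono (f := fun v : V => τ * ‖v‖ ^ 2) (fun v => ?_) ?_
    · have : 0 ≤ (1 / (N : ℝ)) * ∑ m ∈ Finset.range N, ‖x m + K v‖ ^ 2 := by positivity
      simpa [ridge] using this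
    · exact ((Filter.tendsto_pow_atTop two_ne_zero).comp
        (tendsto_norm_cocompact_atTop (E := V))).const_mul_atTop hτ
  obtain ⟨g, hg⟩ := hc.exists_forall_le hlim
  exact ⟨g, g.2, fun v hv => hg ⟨v, hv⟩⟩

/-- The normal equations of a minimiser. -/
theorem normal_equation {K : H →ₗ[ℝ] H} {x : ℕ → H} {N : ℕ} (hN : 1 ≤ N) {τ : ℝ}
    {V : Submodule ℝ H} {g : H} (hgV : g ∈ V) (hg : IsMinOn (ridge K x N τ) V g)
    {v : H} (hv : v ∈ V) :
    inner ℝ ((1 / (N : ℝ)) • ∑ m ∈ Finset.range N, x m + K g) (K v) + τ * inner ℝ g v = 0 := by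
  have hN' : (N : ℝ) ≠ 0 := by positivity
  set b := inner ℝ ((1 / (N : ℝ)) • ∑ m ∈ Finset.range N, x m + K g) (K v) + τ * inner ℝ g v
    with hb
  -- Along a line through the minimiser the increment is a quadratic polynomial without constant
  -- term. Being nonnegative, it has discriminant (2b)² ≤ 0.
  have hexp : ∀ t : ℝ, ridge K x N τ (g + t • v) - ridge K x N τ g
      = (‖K v‖ ^ 2 + τ * ‖v‖ ^ 2) * (t * t) + (2 * b) * t + 0 := by
    intro t
    have h1 : ∀ m, ‖x m + K (g + t • v)‖ ^ 2
        = ‖x m + K g‖ ^ 2 + 2 * t * inner ℝ (x m + K g) (K v) + t ^ 2 * ‖K v‖ ^ 2 := by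
      intro m
      rw [map_add, map_smul, ← add_assoc, norm_add_sq_real, norm_smul, inner_smul_right, mul_pow,
        Real.norm_eq_abs, sq_abs]
      ring
    have h2 : ‖g + t • v‖ ^ 2 = ‖g‖ ^ 2 + 2 * t * inner ℝ g v + t ^ 2 * ‖v‖ ^ 2 := by
      rw [norm_add_sq_real, norm_smul, inner_smul_right, mul_pow, Real.norm_eq_abs, sq_abs]
      ring
    have h3 : inner ℝ ((1 / (N : ℝ)) • ∑ m ∈ Finset.range N, x m + K g) (K v)
        = (1 / (N : ℝ)) * ∑ m ∈ Finset.range N, inner ℝ (x m + K g) (K v) := by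
      simp only [inner_add_left, inner_smul_left, sum_inner, Finset.sum_add_distrib,
        Finset.sum_const, Finset.card_range, nsmul_eq_mul, conj_trivial]
      field_simp
    rw [hb, h3]
    simp only [ridge, h1, h2, Finset.sum_add_distrib, ← Finset.mul_sum, Finset.sum_const,
      Finset.card_range, nsmul_eq_mul]
    field_simp
    ring
  have hquad : ∀ t : ℝ, 0 ≤ (‖K v‖ ^ 2 + τ * ‖v‖ ^ 2) * (t * t) + (2 * b) * t + 0 := by
    intro t
    rw [← hexp]
    exact sub_nonneg.2 (hg (V.add_mem hgV (V.smul_mem t hv)))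
  have hd := discrim_le_zero hquad
  simp only [discrim, mul_zero, sub_zero] at hd
  nlinarith [sq_nonneg b]

/-- The error of a Galerkin solution of the regularised equation with noise `ε`, when the solution
`G` is approximated by an element `h` that satisfies a source condition relative to `J`. -/
theorem galerkin_error_le {K J : H →ₗ[ℝ] H} {V : Submodule ℝ H} [V.HasOrthogonalProjection]
    {c μ τ R : ℝ} (hc : 0 ≤ c) (hμ : 0 ≤ μ) (hτ : 0 < τ) (hR : 0 ≤ R)
    (hJK : ∀ f, ‖J f‖ ≤ c * ‖K f‖) (hKJ : ∀ f, ‖K f‖ ≤ c * ‖J f‖)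
    (hV : ∀ f ∈ Vᗮ, ‖J f‖ ≤ μ * ‖f‖)
    {g G h ε : H} (hgV : g ∈ V)
    (hg : ∀ v ∈ V, inner ℝ (ε - K G + K g) (K v) + τ * inner ℝ g v = 0)
    (hh : ∀ f, |inner ℝ h f| ≤ R * ‖J f‖) :
    ‖g - G‖ ≤ (c * μ * (‖G - h‖ + μ * R) + ‖ε‖ + τ * (R * c)) / √τ
      + ‖G - h‖ + (‖G - h‖ + μ * R) := by
  set Q : H := V.starProjection G with hQ
  have hQV : Q ∈ V := V.starProjection_apply_mem G
  have hperp : ∀ x : H, x - V.starProjection x ∈ Vᗮ := fun x =>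
    V.sub_starProjection_mem_orthogonal x
  set d := ‖G - h‖ with hd
  -- The projection error of G - h is at most `d`. That of `h`, called `y`, satisfies ‖y‖² = ⟨h, y⟩
  -- ≤ R ‖J y‖ ≤ R μ ‖y‖ by the source condition and the smallness of `J` on `Vᗮ`.
  have hGQ : ‖G - Q‖ ≤ d + μ * R := by
    set y := h - V.starProjection h with hy
    have hyh : ‖y‖ ^ 2 ≤ R * (μ * ‖y‖) := by
      have h1 : inner ℝ h y = ‖y‖ ^ 2 := by
        have h2 : inner ℝ (V.starProjection h) y = 0 :=
          (Submodule.mem_orthogonal V y).1 (hperp h) _ (V.starProjection_apply_mem h)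
        rw [← real_inner_self_eq_norm_sq]
        nth_rewrite 2 [hy]
        rw [inner_sub_left, h2, sub_zero]
      rw [← h1]
      exact (le_abs_self _).trans ((hh y).trans
        (mul_le_mul_of_nonneg_left (hV y (hperp h)) hR))
    have hy' : ‖y‖ ≤ μ * R := by
      rcases eq_or_lt_of_le (norm_nonneg y) with h0 | h0
      · rw [← h0]; positivity
      · nlinarith
    have hz : ‖(G - h) - V.starProjection (G - h)‖ ≤ d := by
      set z := (G - h) - V.starProjection (G - h) with hz
      have h2 : inner ℝ (V.starProjection (G - h)) z = 0 :=
        (Submodule.mem_orthogonal V z).1 (hperp _) _ (V.starProjection_apply_mem _)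
      have h3 : ‖z‖ ^ 2 = inner ℝ (G - h) z := by
        rw [← real_inner_self_eq_norm_sq]
        nth_rewrite 1 [hz]
        rw [inner_sub_left, h2, sub_zero]
      have h4 := real_inner_le_norm (G - h) z
      rcases eq_or_lt_of_le (norm_nonneg z) with h0 | h0
      · rw [← h0]; exact norm_nonneg _
      · nlinarith
    have e : G - Q = ((G - h) - V.starProjection (G - h)) + y := by
      rw [hy, hQ, map_sub]; abel
    rw [e]
    exact (norm_add_le _ _).trans (add_le_add hz hy')
  set e := g - Q with he
  have heV : e ∈ V := V.sub_mem hgV hQV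
  have hKGQ : ‖K (G - Q)‖ ≤ c * μ * (d + μ * R) :=
    calc ‖K (G - Q)‖ ≤ c * ‖J (G - Q)‖ := hKJ _
      _ ≤ c * (μ * ‖G - Q‖) := mul_le_mul_of_nonneg_left (hV _ (hperp G)) hc
      _ ≤ c * (μ * (d + μ * R)) := by gcongr
      _ = c * μ * (d + μ * R) := by ring
  set a := c * μ * (d + μ * R) + ‖ε‖ + τ * (R * c) with ha
  have ha0 : 0 ≤ a := by positivity
  have hQe : inner ℝ Q e = inner ℝ G e := by
    have h2 : inner ℝ e (G - Q) = 0 := (Submodule.mem_orthogonal V _).1 (hperp G) _ heV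
    rw [inner_sub_right, real_inner_comm, real_inner_comm Q] at h2
    linarith
  -- The normal equation is tested with `e`. The penalty leaves ⟨G, e⟩, split at `h`: the part from
  -- G - h is paid for by ‖e‖, the part from `h` by ‖K e‖ through the source condition.
  have hmain : ‖K e‖ ^ 2 + τ * ‖e‖ ^ 2 ≤ a * ‖K e‖ + τ * (d * ‖e‖) := by
    have h1 := hg e heV
    have h2 : ε - K G + K g = K e + (ε - K (G - Q)) := by
      rw [he, map_sub, map_sub]; abel
    have h3 : inner ℝ g e = ‖e‖ ^ 2 + inner ℝ G e := by
      rw [← hQe, ← real_inner_self_eq_norm_sq, ← inner_add_left, he, sub_add_cancel]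
    rw [h2, inner_add_left, real_inner_self_eq_norm_sq, h3] at h1
    have h4 : -inner ℝ (ε - K (G - Q)) (K e) ≤ (‖ε‖ + c * μ * (d + μ * R)) * ‖K e‖ := by
      refine (neg_le_abs _).trans ((abs_real_inner_le_norm _ _).trans ?_)
      exact mul_le_mul_of_nonneg_right
        ((norm_sub_le _ _).trans (add_le_add le_rfl hKGQ)) (norm_nonneg _)
    have h5 : -inner ℝ G e ≤ d * ‖e‖ + R * c * ‖K e‖ := by
      have e1 : inner ℝ G e = inner ℝ (G - h) e + inner ℝ h e := by
        rw [← inner_add_left, sub_add_cancel]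
      have e2 := (neg_le_abs _).trans (abs_real_inner_le_norm (G - h) e)
      have e3 := (neg_le_abs _).trans (hh e)
      have e4 : R * ‖J e‖ ≤ R * (c * ‖K e‖) := mul_le_mul_of_nonneg_left (hJK e) hR
      rw [e1]
      linarith
    have h6 := mul_le_mul_of_nonneg_left h5 hτ.le
    rw [ha]
    linarith
  have hsq : 0 < √τ := Real.sqrt_pos.2 hτ
  have hss : √τ ^ 2 = τ := Real.sq_sqrt hτ.le
  have hd0 : 0 ≤ d := norm_nonneg _
  -- Completing the square in ‖K e‖ leaves x² ≤ a²/4 + (√τ d) x for x = √τ ‖e‖, which is impossible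
  -- when x > a + √τ d.
  have hebound : √τ * ‖e‖ ≤ a + √τ * d := by
    refine abs_le_of_sq_le_sq' ?_ (by positivity) |>.2
    by_contra hcon
    push Not at hcon
    have hx : a + √τ * d < √τ * ‖e‖ := lt_of_pow_lt_pow_left₀ 2 (by positivity) hcon
    have hm : (√τ * ‖e‖) ^ 2 ≤ a ^ 2 / 4 + (√τ * d) * (√τ * ‖e‖) := by
      nlinarith [sq_nonneg (‖K e‖ - a / 2)]
    nlinarith [mul_nonneg hsq.le hd0]
  have hefin : ‖e‖ ≤ a / √τ + d := by
    rw [div_add' _ _ _ hsq.ne', le_div_iff₀ hsq]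
    linarith
  calc ‖g - G‖ = ‖e - (G - Q)‖ := by rw [he]; congr 1; abel
    _ ≤ ‖e‖ + ‖G - Q‖ := norm_sub_le _ _
    _ ≤ _ := add_le_add hefin hGQ

end Hilbert

/-! ### The Hilbert space `L²([0,T])` -/

/-- The space `L²([0,T])`. -/
abbrev LTwo (T : ℝ) : Type := Lp ℝ 2 (volume.restrict (Icc 0 T))

theorem l2norm_eq_norm_toLp {T : ℝ} {f : ℝ → ℝ} (hf : MemLp f 2 (volume.restrict (Icc 0 T))) :
    l2norm T f = ‖hf.toLp f‖ :=
  (Lp.norm_toLp f hf).symm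

theorem l2norm_congr {T : ℝ} {f g : ℝ → ℝ} (h : ∀ t ∈ Icc 0 T, f t = g t) :
    l2norm T f = l2norm T g := by
  unfold l2norm
  rw [eLpNorm_congr_ae ((ae_restrict_iff' measurableSet_Icc).2 (ae_of_all _ h))]

theorem inner_toLp {T : ℝ} (hT : 0 ≤ T) {f g : ℝ → ℝ}
    (hf : MemLp f 2 (volume.restrict (Icc 0 T))) (hg : MemLp g 2 (volume.restrict (Icc 0 T))) :
    inner ℝ (hf.toLp f) (hg.toLp g) = ∫ t in (0 : ℝ)..T, f t * g t := by
  rw [L2.inner_def, intervalIntegral.integral_of_le hT, ← integral_Icc_eq_integral_Ioc]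
  refine integral_congr_ae ?_
  filter_upwards [hf.coeFn_toLp, hg.coeFn_toLp] with x h1 h2
  simp [h1, h2, mul_comm]

theorem norm_toLp_sq {T : ℝ} (hT : 0 ≤ T) {f : ℝ → ℝ}
    (hf : MemLp f 2 (volume.restrict (Icc 0 T))) :
    ‖hf.toLp f‖ ^ 2 = ∫ t in (0 : ℝ)..T, f t ^ 2 := by
  rw [← real_inner_self_eq_norm_sq, inner_toLp hT]
  simp only [sq]

/-- The Volterra operator of a continuous function on `L²([0,T])`. -/
def volterraLp {T : ℝ} (hT : 0 ≤ T) {u : ℝ → ℝ} (hu : ContinuousOn u (Icc 0 T)) :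
    LTwo T →ₗ[ℝ] LTwo T where
  toFun F := (volterra_memLp hT hu (Lp.memLp F)).toLp _
  map_add' F₁ F₂ := by
    rw [← MemLp.toLp_add]
    refine MemLp.toLp_congr _ _ ((ae_restrict_iff' measurableSet_Icc).2 (ae_of_all _ fun t ht => ?_))
    rw [volterra_congr ht (Lp.coeFn_add F₁ F₂), Pi.add_apply]
    simp only [volterra, Pi.add_apply, mul_add]
    exact intervalIntegral.integral_add (volterra_intervalIntegrable ht hu (Lp.memLp F₁))
      (volterra_intervalIntegrable ht hu (Lp.memLp F₂))
  map_smul' c F := by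
    rw [RingHom.id_apply, ← MemLp.toLp_const_smul]
    refine MemLp.toLp_congr _ _ ((ae_restrict_iff' measurableSet_Icc).2 (ae_of_all _ fun t ht => ?_))
    rw [volterra_congr ht (Lp.coeFn_smul c F), Pi.smul_apply]
    simp only [volterra, Pi.smul_apply, smul_eq_mul, mul_left_comm _ c]
    exact intervalIntegral.integral_const_mul _ _

theorem volterraLp_toLp {T : ℝ} (hT : 0 ≤ T) {u : ℝ → ℝ} (hu : ContinuousOn u (Icc 0 T))
    {f : ℝ → ℝ} (hf : MemLp f 2 (volume.restrict (Icc 0 T))) :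
    volterraLp hT hu (hf.toLp f) = (volterra_memLp hT hu hf).toLp _ :=
  MemLp.toLp_congr (volterra_memLp hT hu (Lp.memLp (hf.toLp f))) _ ((ae_restrict_iff' measurableSet_Icc).2
    (ae_of_all _ fun _ ht => volterra_congr ht hf.coeFn_toLp))

/-- The primitive as an operator on `L²([0,T])`. -/
def primitiveLp {T : ℝ} (hT : 0 ≤ T) : LTwo T →ₗ[ℝ] LTwo T :=
  volterraLp hT (u := fun _ => 1) continuousOn_const

theorem norm_volterraLp_sq {T : ℝ} (hT : 0 ≤ T) {u : ℝ → ℝ} (hu : ContinuousOn u (Icc 0 T))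
    (F : LTwo T) : ‖volterraLp hT hu F‖ ^ 2 = ∫ t in (0 : ℝ)..T, volterra u F t ^ 2 :=
  norm_toLp_sq hT (volterra_memLp hT hu (Lp.memLp F))

theorem norm_primitiveLp_sq {T : ℝ} (hT : 0 ≤ T) (F : LTwo T) :
    ‖primitiveLp hT F‖ ^ 2 = ∫ t in (0 : ℝ)..T, (∫ s in (0 : ℝ)..t, F s) ^ 2 := by
  rw [primitiveLp, norm_volterraLp_sq]
  simp only [volterra_one]

theorem le_sqrt_mul_of_sq_le {x y c : ℝ} (hy : 0 ≤ y) (hc : 0 ≤ c)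
    (h : x ^ 2 ≤ c * y ^ 2) : x ≤ √c * y := by
  refine (abs_le_of_sq_le_sq' ?_ (by positivity)).2
  rwa [mul_pow, Real.sq_sqrt hc]

/-- The norms `‖∫₀ f‖` and `‖𝐮 f‖` are equivalent. -/
theorem exists_norm_equiv {T : ℝ} (hT : 0 ≤ T) {u : ℝ → ℝ} (hu : MemH1 0 T u) (hu0 : u 0 ≠ 0) :
    ∃ c : ℝ, 0 ≤ c ∧
      (∀ F, ‖primitiveLp hT F‖ ≤ c * ‖volterraLp hT (memH1_continuousOn hT hu) F‖) ∧
      (∀ F, ‖volterraLp hT (memH1_continuousOn hT hu) F‖ ≤ c * ‖primitiveLp hT F‖) := by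
  obtain ⟨c₁, hc₁, h₁⟩ := integral_sq_primitive_le hT hu hu0
  obtain ⟨c₂, hc₂, h₂⟩ := integral_sq_volterra_le hT hu
  refine ⟨√c₁ + √c₂, by positivity, fun F => ?_, fun F => ?_⟩
  · refine (le_sqrt_mul_of_sq_le (norm_nonneg _) hc₁ ?_).trans
      (mul_le_mul_of_nonneg_right (le_add_of_nonneg_right (Real.sqrt_nonneg c₂)) (norm_nonneg _))
    rw [norm_primitiveLp_sq, norm_volterraLp_sq]
    exact h₁ F (Lp.memLp F)
  · refine (le_sqrt_mul_of_sq_le (norm_nonneg _) hc₂ ?_).trans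
      (mul_le_mul_of_nonneg_right (le_add_of_nonneg_left (Real.sqrt_nonneg c₁)) (norm_nonneg _))
    rw [norm_primitiveLp_sq, norm_volterraLp_sq]
    exact h₂ F (Lp.memLp F)

/-! ### Piecewise constant functions -/

/-- The indicator of a cell of a partition. -/
def cell (T : ℝ) {N : ℕ} (π : Fin (N + 1) → ℝ) (i : Fin N) : LTwo T :=
  indicatorConstLp 2 (measurableSet_Ico (a := π i.castSucc) (b := π i.succ))
    (measure_ne_top _ _) (1 : ℝ)

/-- The span of the indicators of the cells. -/
def stepSpace (T : ℝ) {N : ℕ} (π : Fin (N + 1) → ℝ) : Submodule ℝ (LTwo T) :=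
  Submodule.span ℝ (range (cell T π))

instance (T : ℝ) {N : ℕ} (π : Fin (N + 1) → ℝ) : FiniteDimensional ℝ (stepSpace T π) :=
  FiniteDimensional.span_of_finite ℝ (finite_range _)

theorem memLp_indicator_Ico (T a b c : ℝ) :
    MemLp ((Ico a b).indicator fun _ => c) 2 (volume.restrict (Icc 0 T)) :=
  memLp_indicator_const 2 measurableSet_Ico c (Or.inr (measure_ne_top _ _))

theorem toLp_sum_indicator (T : ℝ) {N : ℕ} (π : Fin (N + 1) → ℝ) (c : Fin N → ℝ)
    (h : MemLp (fun t => ∑ i : Fin N, (Ico (π i.castSucc) (π i.succ)).indicator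
      (fun _ => c i) t) 2 (volume.restrict (Icc 0 T))) :
    h.toLp _ = ∑ i, c i • cell T π i := by
  refine Lp.ext ?_
  have h1 : (((∑ i, c i • cell T π i : LTwo T)) : ℝ → ℝ) =ᵐ[volume.restrict (Icc 0 T)]
      fun t => ∑ i, ((c i • cell T π i : LTwo T) : ℝ → ℝ) t := by
    have := Lp.coeFn_finsetSum Finset.univ fun i => c i • cell T π i
    filter_upwards [this] with t ht
    rw [ht, Finset.sum_apply]
  have h2 : ∀ i, ((c i • cell T π i : LTwo T) : ℝ → ℝ) =ᵐ[volume.restrict (Icc 0 T)]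
      (Ico (π i.castSucc) (π i.succ)).indicator fun _ => c i := by
    intro i
    filter_upwards [Lp.coeFn_smul (c i) (cell T π i),
      indicatorConstLp_coeFn (p := 2) (μ := volume.restrict (Icc 0 T))
        (hs := measurableSet_Ico (a := π i.castSucc) (b := π i.succ))
        (hμs := measure_ne_top _ _) (c := (1 : ℝ))] with t h1 h2
    rw [h1, Pi.smul_apply, cell, h2]
    by_cases ht : t ∈ Ico (π i.castSucc) (π i.succ) <;> simp [ht]
  filter_upwards [h.coeFn_toLp, h1, ae_all_iff.2 h2] with t e1 e2 e3
  rw [e1, e2]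
  exact Finset.sum_congr rfl fun i _ => (e3 i).symm

theorem memLp_sum_indicator (T : ℝ) {N : ℕ} (π : Fin (N + 1) → ℝ) (c : Fin N → ℝ) :
    MemLp (fun t => ∑ i : Fin N, (Ico (π i.castSucc) (π i.succ)).indicator
      (fun _ => c i) t) 2 (volume.restrict (Icc 0 T)) :=
  memLp_finsetSum _ fun _ _ => memLp_indicator_Ico T _ _ _

theorem memLp_of_mem_piecewiseConst {T : ℝ} {N : ℕ} {π : Fin (N + 1) → ℝ} {f : ℝ → ℝ}
    (hf : f ∈ piecewiseConst T π) : MemLp f 2 (volume.restrict (Icc 0 T)) :=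
  (memLp_congr_ae ((ae_restrict_iff' measurableSet_Icc).2 (ae_of_all _ hf))).2
    (memLp_sum_indicator T π fun i => f (π i.castSucc))

theorem toLp_mem_stepSpace {T : ℝ} {N : ℕ} {π : Fin (N + 1) → ℝ} {f : ℝ → ℝ}
    (hf : f ∈ piecewiseConst T π) :
    (memLp_of_mem_piecewiseConst hf).toLp f ∈ stepSpace T π := by
  rw [MemLp.toLp_congr _ (memLp_sum_indicator T π fun i => f (π i.castSucc))
    ((ae_restrict_iff' measurableSet_Icc).2 (ae_of_all _ hf)), toLp_sum_indicator]
  exact Submodule.sum_mem _ fun i _ =>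
    Submodule.smul_mem _ _ (Submodule.subset_span (mem_range_self i))

/-- An element of `stepSpace` is a class modulo null sets, while `piecewiseConst` is a pointwise
condition. The sum of indicators is the right representative: the cells are disjoint and contain
their left nodes, so its nodal values are the coefficients. -/
theorem exists_piecewiseConst_of_mem_stepSpace {T : ℝ} {N : ℕ} {π : Fin (N + 1) → ℝ}
    (hπ : StrictMono π) {F : LTwo T} (hF : F ∈ stepSpace T π) :
    ∃ f, ∃ hf : f ∈ piecewiseConst T π, (memLp_of_mem_piecewiseConst hf).toLp f = F := by
  obtain ⟨c, rfl⟩ := (Submodule.mem_span_range_iff_exists_fun ℝ).1 hF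
  set f : ℝ → ℝ := fun t => ∑ i : Fin N, (Ico (π i.castSucc) (π i.succ)).indicator
      (fun _ => c i) t with hfdef
  have hval : ∀ i : Fin N, f (π i.castSucc) = c i := by
    intro i
    rw [hfdef]
    simp only
    rw [Finset.sum_eq_single i]
    · rw [indicator_of_mem]
      exact ⟨le_rfl, hπ Fin.castSucc_lt_succ⟩
    · intro j _ hj
      refine indicator_of_notMem (fun hmem => hj ?_) _
      have h1 := hπ.le_iff_le.1 hmem.1
      have h2 := hπ.lt_iff_lt.1 hmem.2
      rw [Fin.le_def] at h1
      rw [Fin.lt_def] at h2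
      simp only [Fin.val_castSucc, Fin.val_succ] at h1 h2
      exact Fin.ext (by omega)
    · simp
  have hf : f ∈ piecewiseConst T π := fun t _ => by simp only [hval]; rfl
  exact ⟨f, hf, toLp_sum_indicator T π c _⟩

/-- The primitive is small on the orthogonal complement of the step functions. -/
theorem norm_primitiveLp_le_mesh {T : ℝ} (hT : 0 ≤ T) {N : ℕ} {π : Fin (N + 1) → ℝ}
    (hπ : IsPartition T π) {F : LTwo T} (hF : F ∈ (stepSpace T π)ᗮ) :
    ‖primitiveLp hT F‖ ≤ mesh π * ‖F‖ := by
  -- Orthogonality to the indicator of a cell is the vanishing of the cell average.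
  have h0 : ∀ i : Fin N, ∫ x in (π i.castSucc)..(π i.succ), F x = 0 := by
    intro i
    have h1 := (Submodule.mem_orthogonal _ F).1 hF (cell T π i)
      (Submodule.subset_span (mem_range_self i))
    have hle : π i.castSucc ≤ π i.succ := hπ.1.monotone (Fin.castSucc_lt_succ).le
    rw [cell, L2.inner_indicatorConstLp_one, Measure.restrict_restrict measurableSet_Ico,
      inter_eq_left.2] at h1
    · rwa [intervalIntegral.integral_of_le hle, ← integral_Ico_eq_integral_Ioc]
    · exact fun x hx => ⟨(hπ.mem_Icc _).1.trans hx.1, hx.2.le.trans (hπ.mem_Icc _).2⟩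
  have h := integral_sq_primitive_le_mesh hπ (Lp.memLp F) h0
  refine (abs_le_of_sq_le_sq' ?_ (mul_nonneg (mesh_nonneg hπ.1) (norm_nonneg _))).2
  have hn : ‖F‖ ^ 2 = ∫ t in (0 : ℝ)..T, F t ^ 2 := by
    rw [← norm_toLp_sq hT (Lp.memLp F), Lp.toLp_coeFn]
  rwa [norm_primitiveLp_sq, mul_pow, hn]

/-! ### Approximation of the kernel by functions satisfying a source condition -/

/-- The tail integral of `k` is the adjoint of the primitive applied to `k`, so Cauchy–Schwarz after
moving the adjoint across gives a source condition with R = ‖k‖. -/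
theorem abs_inner_tail_le {T : ℝ} (hT : 0 ≤ T) {k : ℝ → ℝ}
    (hk : MemLp k 2 (volume.restrict (Icc 0 T)))
    (hh : MemLp (fun t => ∫ s in t..T, k s) 2 (volume.restrict (Icc 0 T))) (F : LTwo T) :
    |inner ℝ (hh.toLp _) F| ≤ ‖hk.toLp k‖ * ‖primitiveLp hT F‖ := by
  have hJ : MemLp (volterra (fun _ => 1) F) 2 (volume.restrict (Icc 0 T)) :=
    volterra_memLp hT continuousOn_const (Lp.memLp F)
  have h1 : inner ℝ (hh.toLp _) F = inner ℝ (hk.toLp k) (primitiveLp hT F) := by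
    have e : F = (Lp.memLp F).toLp _ := (Lp.toLp_coeFn F _).symm
    calc inner ℝ (hh.toLp _) F = inner ℝ (hh.toLp _) ((Lp.memLp F).toLp _) := by rw [← e]
      _ = ∫ t in (0 : ℝ)..T, (∫ s in t..T, k s) * F t := inner_toLp hT hh _
      _ = ∫ t in (0 : ℝ)..T, k t * volterra (fun _ => 1) F t := by
          simp only [volterra_one]
          exact integral_primitive_mul (memLp_intervalIntegrable hT hk)
            (memLp_intervalIntegrable hT (Lp.memLp F))
      _ = inner ℝ (hk.toLp k) (primitiveLp hT F) := (inner_toLp hT hk hJ).symm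
  rw [h1]
  exact abs_real_inner_le_norm _ _

/-- Freezing `G` on `[0,δ]` and cutting it off linearly on `[T-δ,T]` gives a function satisfying
a source condition. -/
theorem exists_source_approx {T δ X Y B : ℝ} (hδ : 0 < δ) (hδT : δ ≤ T - δ)
    {G : ℝ → ℝ} (hG : MemLp G 2 (volume.restrict (Icc 0 T)))
    (hG' : MemLp (deriv G) 2 (volume.restrict (Icc δ T)))
    (hftc : ∀ t ∈ Icc δ T, ∫ s in t..T, deriv G s = G T - G t)
    (hX : ∫ t in (0 : ℝ)..δ, (G t - G δ) ^ 2 ≤ X)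
    (hY : ∫ t in δ..T, deriv G t ^ 2 ≤ Y) (hB : ∀ t ∈ Icc (T - δ) T, |G t| ≤ B) :
    ∃ (hT : 0 ≤ T) (h : LTwo T) (R : ℝ), 0 ≤ R ∧
      (∀ F, |inner ℝ h F| ≤ R * ‖primitiveLp hT F‖) ∧
      ‖hG.toLp G - h‖ ^ 2 ≤ X + 4 * B ^ 2 * δ ∧ R ^ 2 ≤ Y + B ^ 2 / δ := by
  have hT : 0 ≤ T := by linarith
  have hTδ : T - δ ≤ T := by linarith
  have hT0 : 0 ≤ T - δ := by linarith
  have hδT' : δ ≤ T := by linarith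
  -- The approximant is the tail integral of `k`. The value 0 of `k` up to `δ` freezes it at G(δ),
  -- the value -G' makes it equal to `G` in the middle, and the constant `c` on the last stretch
  -- lets it fall linearly from G(T - δ) to 0.
  set c : ℝ := G (T - δ) / δ with hc
  set k : ℝ → ℝ := fun t => (Ioc δ (T - δ)).indicator (fun s => -deriv G s) t
    + (Ioi (T - δ)).indicator (fun _ => c) t with hkdef
  have hk : MemLp k 2 (volume.restrict (Icc 0 T)) := by
    refine MemLp.add ?_ ?_
    · rw [memLp_indicator_iff_restrict measurableSet_Ioc, Measure.restrict_restrict measurableSet_Ioc]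
      refine hG'.neg.mono_measure (Measure.restrict_mono ?_ le_rfl)
      exact fun x hx => ⟨hx.1.1.le, hx.2.2⟩
    · exact memLp_indicator_const 2 measurableSet_Ioi c (Or.inr (measure_ne_top _ _))
  have hk1 : ∀ s, s ≤ δ → k s = 0 := by
    intro s hs
    have h1 : s ∉ Ioc δ (T - δ) := fun h => not_lt.2 hs h.1
    have h2 : s ∉ Ioi (T - δ) := fun h => not_lt.2 (hs.trans hδT) h
    simp only [hkdef, indicator_of_notMem h1, indicator_of_notMem h2, add_zero]
  have hk2 : ∀ s, δ < s → s ≤ T - δ → k s = -deriv G s := by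
    intro s hs hs'
    have h2 : s ∉ Ioi (T - δ) := fun h => not_lt.2 hs' h
    simp only [hkdef, indicator_of_mem (show s ∈ Ioc δ (T - δ) from ⟨hs, hs'⟩),
      indicator_of_notMem h2, add_zero]
  have hk3 : ∀ s, T - δ < s → k s = c := by
    intro s hs
    have h1 : s ∉ Ioc δ (T - δ) := fun h => not_lt.2 h.2 hs
    simp only [hkdef, indicator_of_mem (show s ∈ Ioi (T - δ) from hs),
      indicator_of_notMem h1, zero_add]
  have hki := memLp_intervalIntegrable hT hk
  have hki' : ∀ a b, a ∈ Icc 0 T → b ∈ Icc 0 T → IntervalIntegrable k volume a b :=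
    fun a b ha hb => hki.mono_set (by
      rw [uIcc_of_le hT]; exact (convex_Icc 0 T).ordConnected.uIcc_subset ha hb)
  have hcongr : ∀ {p q : ℝ → ℝ} {a b : ℝ}, a ≤ b → (∀ s, a < s → s ≤ b → p s = q s) →
      ∫ s in a..b, p s = ∫ s in a..b, q s := by
    intro p q a b hab hpq
    refine intervalIntegral.integral_congr_ae (ae_of_all _ fun s hs => ?_)
    rw [uIoc_of_le hab] at hs
    exact hpq s hs.1 hs.2
  have hh3 : ∀ t ∈ Icc (T - δ) T, ∫ s in t..T, k s = (T - t) * c := by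
    intro t ht
    rw [hcongr ht.2 fun s hs _ => hk3 s (ht.1.trans_lt hs), intervalIntegral.integral_const,
      smul_eq_mul]
  have hh2 : ∀ t ∈ Icc δ (T - δ), ∫ s in t..T, k s = G t := by
    intro t ht
    have ht0 : t ∈ Icc 0 T := ⟨hδ.le.trans ht.1, ht.2.trans hTδ⟩
    rw [← intervalIntegral.integral_add_adjacent_intervals (hki' t (T - δ) ht0 ⟨hT0, hTδ⟩)
      (hki' _ _ ⟨hT0, hTδ⟩ ⟨hT, le_rfl⟩), hh3 _ ⟨le_rfl, hTδ⟩,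
      hcongr ht.2 fun s hs hs' => hk2 s (ht.1.trans_lt hs) hs', intervalIntegral.integral_neg]
    have hd1 : IntervalIntegrable (deriv G) volume t T :=
      memLp_intervalIntegrable ht0.2 (memLp_mono_Icc hG' ht.1 le_rfl)
    have hd2 : IntervalIntegrable (deriv G) volume (T - δ) T :=
      memLp_intervalIntegrable hTδ (memLp_mono_Icc hG' hδT le_rfl)
    have e := intervalIntegral.integral_add_adjacent_intervals (hd1.trans hd2.symm) hd2
    rw [hftc t ⟨ht.1, ht0.2⟩, hftc (T - δ) ⟨hδT, hTδ⟩] at e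
    have e2 : (T - (T - δ)) * c = G (T - δ) := by rw [hc]; field_simp; ring
    rw [e2]
    linarith
  have hh1 : ∀ t ∈ Icc 0 δ, ∫ s in t..T, k s = G δ := by
    intro t ht
    rw [← intervalIntegral.integral_add_adjacent_intervals
      (hki' t δ ⟨ht.1, ht.2.trans hδT'⟩ ⟨hδ.le, hδT'⟩) (hki' δ T ⟨hδ.le, hδT'⟩ ⟨hT, le_rfl⟩),
      hh2 δ ⟨le_rfl, hδT⟩, hcongr ht.2 fun s _ hs' => hk1 s hs',
      intervalIntegral.integral_zero, zero_add]
  have hh : MemLp (fun t => ∫ s in t..T, k s) 2 (volume.restrict (Icc 0 T)) := by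
    have h1 := (hki.absolutelyContinuousOnInterval_intervalIntegral (c := T)
      (by simp)).continuousOn.neg
    rw [uIcc_of_le hT] at h1
    refine continuousOn_memLp (h1.congr fun t _ => ?_)
    rw [intervalIntegral.integral_symm]
    rfl
  have hsplit : ∀ {p : ℝ → ℝ}, IntervalIntegrable p volume 0 T → ∫ t in (0 : ℝ)..T, p t
      = (∫ t in (0 : ℝ)..δ, p t) + (∫ t in δ..(T - δ), p t) + ∫ t in (T - δ)..T, p t := by
    intro p hp
    have hp' : ∀ a b, a ∈ Icc 0 T → b ∈ Icc 0 T → IntervalIntegrable p volume a b :=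
      fun a b ha hb => hp.mono_set (by
        rw [uIcc_of_le hT]; exact (convex_Icc 0 T).ordConnected.uIcc_subset ha hb)
    rw [intervalIntegral.integral_add_adjacent_intervals
        (hp' 0 δ ⟨le_rfl, hT⟩ ⟨hδ.le, hδT'⟩) (hp' _ _ ⟨hδ.le, hδT'⟩ ⟨hT0, hTδ⟩),
      intervalIntegral.integral_add_adjacent_intervals
        (hp' _ _ ⟨le_rfl, hT⟩ ⟨hT0, hTδ⟩) (hp' _ _ ⟨hT0, hTδ⟩ ⟨hT, le_rfl⟩)]
  have hB0 : 0 ≤ B := (abs_nonneg _).trans (hB T ⟨hTδ, le_rfl⟩)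
  refine ⟨hT, hh.toLp _, ‖hk.toLp k‖, norm_nonneg _, abs_inner_tail_le hT hk hh, ?_, ?_⟩
  · rw [← MemLp.toLp_sub, norm_toLp_sq hT, hsplit (memLp_intervalIntegrable_sq hT (hG.sub hh))]
    have e1 : ∫ t in (0 : ℝ)..δ, (G - fun t => ∫ s in t..T, k s) t ^ 2
        = ∫ t in (0 : ℝ)..δ, (G t - G δ) ^ 2 :=
      hcongr hδ.le fun s h1 h2 => by rw [Pi.sub_apply, hh1 s ⟨h1.le, h2⟩]
    have e2 : ∫ t in δ..(T - δ), (G - fun t => ∫ s in t..T, k s) t ^ 2 = 0 := by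
      rw [hcongr (q := fun _ => 0) hδT fun s h1 h2 => by
        rw [Pi.sub_apply, hh2 s ⟨h1.le, h2⟩, sub_self, zero_pow two_ne_zero]]
      simp
    have e3 : ∫ t in (T - δ)..T, (G - fun t => ∫ s in t..T, k s) t ^ 2
        ≤ ∫ _ in (T - δ)..T, 4 * B ^ 2 := by
      refine intervalIntegral.integral_mono_on hTδ
        (memLp_intervalIntegrable_sq hTδ (memLp_mono_Icc (hG.sub hh) hT0 le_rfl))
        intervalIntegrable_const fun t ht => ?_
      rw [Pi.sub_apply, hh3 t ht]
      have h1 := hB t ht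
      have h2 : |(T - t) * c| ≤ B := by
        have h3 := hB (T - δ) ⟨le_rfl, hTδ⟩
        rw [hc, abs_mul, abs_div, abs_of_pos hδ, abs_of_nonneg (by linarith [ht.2]),
          mul_div_assoc', div_le_iff₀ hδ, mul_comm B]
        exact mul_le_mul (by linarith [ht.1]) h3 (abs_nonneg _) hδ.le
      have h4 : |G t - (T - t) * c| ≤ 2 * B := (abs_sub _ _).trans (by linarith)
      calc (G t - (T - t) * c) ^ 2 ≤ (2 * B) ^ 2 := sq_le_sq' (abs_le.1 h4).1 (abs_le.1 h4).2
        _ = 4 * B ^ 2 := by ring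
    rw [intervalIntegral.integral_const, smul_eq_mul] at e3
    rw [e1, e2]
    linarith
  · rw [norm_toLp_sq hT, hsplit (memLp_intervalIntegrable_sq hT hk)]
    have e1 : ∫ t in (0 : ℝ)..δ, k t ^ 2 = 0 := by
      rw [hcongr (q := fun _ => 0) hδ.le fun s _ h2 => by
        rw [hk1 s h2, zero_pow two_ne_zero]]
      simp
    have e2 : ∫ t in δ..(T - δ), k t ^ 2 ≤ Y := by
      rw [hcongr (q := fun t => deriv G t ^ 2) hδT fun s h1 h2 => by rw [hk2 s h1 h2, neg_sq]]
      exact (intervalIntegral.integral_mono_interval le_rfl hδT hTδ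
        (ae_of_all _ fun s => sq_nonneg _) (memLp_intervalIntegrable_sq hδT' hG')).trans hY
    have e3 : ∫ t in (T - δ)..T, k t ^ 2 ≤ B ^ 2 / δ := by
      rw [hcongr (q := fun _ => c ^ 2) hTδ fun s h1 _ => by rw [hk3 s h1],
        intervalIntegral.integral_const, smul_eq_mul]
      have h3 := hB (T - δ) ⟨le_rfl, hTδ⟩
      have h4 : G (T - δ) ^ 2 ≤ B ^ 2 := sq_le_sq' (abs_le.1 h3).1 (abs_le.1 h3).2
      have e : (T - (T - δ)) * c ^ 2 = G (T - δ) ^ 2 / δ := by rw [hc]; field_simp; ring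
      rw [e]
      gcongr
    linarith

/-- The kernel `G` is approximated at rate `σ ^ (1/2 - α)` by functions satisfying a source
condition. -/
def HasSourceRate {T : ℝ} (hT : 0 ≤ T) (α : ℝ) (G : LTwo T) : Prop :=
  ∃ B : ℝ, 0 ≤ B ∧ ∀ σ : ℝ, 0 < σ → ∃ (h : LTwo T) (R : ℝ), 0 ≤ R ∧
    (∀ F, |inner ℝ h F| ≤ R * ‖primitiveLp hT F‖) ∧ ‖G - h‖ + σ * R ≤ B * σ ^ (1 / 2 - α)

/-- For small σ take δ = σ. For σ > δ₀ the choice h = 0, R = 0 suffices, since σ^(1/2 - α) is then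
bounded below. -/
theorem hasSourceRate_of_local {T : ℝ} (hT : 0 ≤ T) {α : ℝ} (hα : α < 1 / 2) {G : LTwo T}
    {B δ₀ : ℝ} (hB : 0 ≤ B) (hδ₀ : 0 < δ₀)
    (hloc : ∀ δ : ℝ, 0 < δ → δ ≤ δ₀ → ∃ (h : LTwo T) (R : ℝ), 0 ≤ R ∧
      (∀ F, |inner ℝ h F| ≤ R * ‖primitiveLp hT F‖) ∧
      ‖G - h‖ ^ 2 ≤ B * δ ^ (1 - 2 * α) ∧ R ^ 2 ≤ B * δ ^ (-1 - 2 * α)) :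
    HasSourceRate hT α G := by
  have hα' : 0 < 1 / 2 - α := by linarith
  refine ⟨2 * √B + ‖G‖ / δ₀ ^ (1 / 2 - α), by positivity, fun σ hσ => ?_⟩
  have hsq : ∀ q : ℝ, (σ ^ q) ^ 2 = σ ^ (2 * q) := fun q => by
    rw [← Real.rpow_natCast, ← Real.rpow_mul hσ.le, mul_comm]; norm_num
  rcases le_or_gt σ δ₀ with hle | hlt
  · obtain ⟨h, R, hR, hdual, h1, h2⟩ := hloc σ hσ hle
    refine ⟨h, R, hR, hdual, ?_⟩
    have e1 : ‖G - h‖ ≤ √B * σ ^ (1 / 2 - α) := by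
      refine le_sqrt_mul_of_sq_le (by positivity) hB ?_
      rw [hsq, show 2 * (1 / 2 - α) = 1 - 2 * α by ring]
      exact h1
    have e2 : R ≤ √B * σ ^ (-1 / 2 - α) := by
      refine le_sqrt_mul_of_sq_le (by positivity) hB ?_
      rw [hsq, show 2 * (-1 / 2 - α) = -1 - 2 * α by ring]
      exact h2
    have e3 : σ * R ≤ √B * σ ^ (1 / 2 - α) :=
      calc σ * R ≤ σ * (√B * σ ^ (-1 / 2 - α)) := mul_le_mul_of_nonneg_left e2 hσ.le
        _ = √B * (σ ^ (1 : ℝ) * σ ^ (-1 / 2 - α)) := by rw [Real.rpow_one]; ring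
        _ = √B * σ ^ (1 / 2 - α) := by rw [← Real.rpow_add hσ]; congr 2; ring
    have e4 : 0 ≤ ‖G‖ / δ₀ ^ (1 / 2 - α) * σ ^ (1 / 2 - α) := by positivity
    linarith
  · refine ⟨0, 0, le_rfl, fun F => by simp, ?_⟩
    have e1 : δ₀ ^ (1 / 2 - α) ≤ σ ^ (1 / 2 - α) := Real.rpow_le_rpow hδ₀.le hlt.le hα'.le
    have e2 : ‖G‖ ≤ ‖G‖ / δ₀ ^ (1 / 2 - α) * σ ^ (1 / 2 - α) := by
      rw [div_mul_eq_mul_div, le_div_iff₀ (by positivity)]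
      exact mul_le_mul_of_nonneg_left e1 (norm_nonneg _)
    have e3 : 0 ≤ 2 * √B * σ ^ (1 / 2 - α) := by positivity
    rw [sub_zero, mul_zero, add_zero]
    linarith

theorem one_le_rpow_neg {δ q : ℝ} (hδ : 0 < δ) (h1 : δ ≤ 1) (hq : q ≤ 0) : 1 ≤ δ ^ q :=
  Real.one_le_rpow_of_pos_of_le_one_of_nonpos hδ h1 hq

/-- The source approximation rate from local bounds on the kernel near `0`. -/
theorem hasSourceRate_of_bounds {T : ℝ} (hT : 0 ≤ T) {α : ℝ} (hα0 : 0 ≤ α) (hα : α < 1 / 2)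
    {G : ℝ → ℝ} (hG : MemLp G 2 (volume.restrict (Icc 0 T))) {B X Y δ₀ : ℝ}
    (hX0 : 0 ≤ X) (hY0 : 0 ≤ Y) (hδ₀ : 0 < δ₀) (hδ₀1 : δ₀ ≤ 1) (hδ₀T : δ₀ ≤ T - δ₀)
    (hB : ∀ t ∈ Icc (T - δ₀) T, |G t| ≤ B)
    (hG' : ∀ δ : ℝ, 0 < δ → δ ≤ δ₀ → MemLp (deriv G) 2 (volume.restrict (Icc δ T)))
    (hftc : ∀ t ∈ Ioc 0 T, ∫ s in t..T, deriv G s = G T - G t)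
    (hX : ∀ δ : ℝ, 0 < δ → δ ≤ δ₀ → ∫ t in (0 : ℝ)..δ, (G t - G δ) ^ 2 ≤ X * δ ^ (1 - 2 * α))
    (hY : ∀ δ : ℝ, 0 < δ → δ ≤ δ₀ → ∫ t in δ..T, deriv G t ^ 2 ≤ Y * δ ^ (-1 - 2 * α)) :
    HasSourceRate hT α (hG.toLp G) := by
  -- The cut-off at `T` contributes 4B²δ to the squared distance and B²/δ to R². As δ ≤ 1 and α ≥ 0,
  -- both are dominated by the respective powers of δ.
  refine hasSourceRate_of_local hT hα (B := X + Y + 5 * B ^ 2) (by positivity) hδ₀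
    fun δ hδ hδ' => ?_
  obtain ⟨hT', h, R, hR, hdual, h1, h2⟩ := exists_source_approx hδ (by linarith) hG (hG' δ hδ hδ')
    (fun t ht => hftc t ⟨hδ.trans_le ht.1, ht.2⟩) (hX δ hδ hδ') (hY δ hδ hδ')
    (fun t ht => hB t ⟨by linarith [ht.1], ht.2⟩)
  refine ⟨h, R, hR, hdual, h1.trans ?_, h2.trans ?_⟩
  · have e : δ ≤ δ ^ (1 - 2 * α) := by
      calc δ = δ ^ (1 : ℝ) := (Real.rpow_one δ).symm
        _ ≤ δ ^ (1 - 2 * α) :=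
          Real.rpow_le_rpow_of_exponent_ge hδ (hδ'.trans hδ₀1) (by linarith)
    have e0 : 0 ≤ δ ^ (1 - 2 * α) := by positivity
    nlinarith [mul_le_mul_of_nonneg_left e (sq_nonneg B), mul_nonneg hY0 e0,
      mul_nonneg (sq_nonneg B) e0]
  · have e : 1 / δ ≤ δ ^ (-1 - 2 * α) := by
      calc 1 / δ = δ ^ (-1 : ℝ) := by rw [Real.rpow_neg_one, one_div]
        _ ≤ δ ^ (-1 - 2 * α) :=
          Real.rpow_le_rpow_of_exponent_ge hδ (hδ'.trans hδ₀1) (by linarith)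
    have e0 : 0 ≤ δ ^ (-1 - 2 * α) := by positivity
    rw [div_eq_mul_one_div (B ^ 2) δ]
    nlinarith [mul_le_mul_of_nonneg_left e (sq_nonneg B), mul_nonneg hX0 e0,
      mul_nonneg (sq_nonneg B) e0]

theorem integral_deriv_of_memH1 {a b t : ℝ} (hab : a ≤ b) {G : ℝ → ℝ} (hG : MemH1 a b G)
    (ht : t ∈ Icc a b) : ∫ s in t..b, deriv G s = G b - G t := by
  refine (hG.1.mono ?_).integral_deriv_eq_sub
  rw [uIcc_of_le ht.2, uIcc_of_le hab]
  exact Icc_subset_Icc ht.1 le_rfl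

/-- Boundedness of `G` makes the squared freezing error O(δ), and the integral of the squared
derivative is bounded, hence O(1/δ). These are no larger than the orders of the cut-off at `T`. -/
theorem hasSourceRate_regular {T : ℝ} (hT : 0 < T) {G : ℝ → ℝ}
    (hG : MemLp G 2 (volume.restrict (Icc 0 T))) (h : MemH1 0 T G) :
    HasSourceRate hT.le 0 (hG.toLp G) := by
  obtain ⟨B, hB⟩ := isCompact_Icc.exists_bound_of_continuousOn (memH1_continuousOn hT.le h)
  simp only [Real.norm_eq_abs] at hB
  have hB0 : 0 ≤ B := (abs_nonneg _).trans (hB 0 ⟨le_rfl, hT.le⟩)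
  set δ₀ := min 1 (T / 2) with hδ₀
  have h1 : δ₀ ≤ 1 := min_le_left _ _
  have h2 : δ₀ ≤ T / 2 := min_le_right _ _
  have h3 : 0 < δ₀ := lt_min one_pos (by linarith)
  have hY0 : 0 ≤ ∫ t in (0 : ℝ)..T, deriv G t ^ 2 :=
    intervalIntegral.integral_nonneg hT.le fun s _ => sq_nonneg _
  refine hasSourceRate_of_bounds hT.le le_rfl (by norm_num) hG (B := B) (X := 4 * B ^ 2)
    (Y := ∫ t in (0 : ℝ)..T, deriv G t ^ 2) (by positivity) hY0 h3 h1 (by linarith)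
    (fun t ht => hB t ⟨by linarith [ht.1], ht.2⟩)
    (fun δ hδ _ => memLp_mono_Icc h.2 hδ.le le_rfl)
    (fun t ht => integral_deriv_of_memH1 hT.le h ⟨ht.1.le, ht.2⟩) ?_ ?_
  · intro δ hδ hδ'
    have hδT : δ ≤ T := by linarith
    calc ∫ t in (0 : ℝ)..δ, (G t - G δ) ^ 2 ≤ ∫ _ in (0 : ℝ)..δ, 4 * B ^ 2 := by
          refine intervalIntegral.integral_mono_on hδ.le ?_ intervalIntegrable_const fun t ht => ?_
          · exact memLp_intervalIntegrable_sq hδ.le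
              ((memLp_mono_Icc hG le_rfl hδT).sub (continuousOn_memLp continuousOn_const))
          · have e1 := hB t ⟨ht.1, ht.2.trans hδT⟩
            have e2 := hB δ ⟨hδ.le, hδT⟩
            have e3 : |G t - G δ| ≤ 2 * B := (abs_sub _ _).trans (by linarith)
            calc (G t - G δ) ^ 2 ≤ (2 * B) ^ 2 := sq_le_sq' (abs_le.1 e3).1 (abs_le.1 e3).2
              _ = 4 * B ^ 2 := by ring
      _ = 4 * B ^ 2 * δ ^ (1 - 2 * (0 : ℝ)) := by
          rw [intervalIntegral.integral_const, smul_eq_mul]; norm_num; ring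
  · intro δ hδ hδ'
    have hδT : δ ≤ T := by linarith
    refine (intervalIntegral.integral_mono_interval hδ.le hδT le_rfl
      (ae_of_all _ fun s => sq_nonneg _) (memLp_intervalIntegrable_sq hT.le h.2)).trans ?_
    exact le_mul_of_one_le_right hY0 (one_le_rpow_neg hδ (hδ'.trans h1) (by norm_num))

/-- Integrating the derivative bound gives |G(t) - G(δ)| ≤ (C₀/α) t^(-α), whose square is integrable
because 2α < 1 and has integral of order δ^(1 - 2α) over (0, δ). The squared derivative bound t^(-2α
- 2) integrates to order δ^(-1 - 2α) beyond δ. -/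
theorem hasSourceRate_singular {T α : ℝ} (hT : 0 < T) (hα : α ∈ Ioo (0 : ℝ) (1 / 2))
    {G : ℝ → ℝ} (hG : MemLp G 2 (volume.restrict (Icc 0 T))) (h : IsSingularKernel T α G) :
    HasSourceRate hT.le α (hG.toLp G) := by
  obtain ⟨t₀, ht₀, C₀, hC₀, hac, hbd, hH⟩ := h
  have hα0 : 0 < α := hα.1
  obtain ⟨B, hB⟩ := isCompact_Icc.exists_bound_of_continuousOn (memH1_continuousOn ht₀.2.le hH)
  simp only [Real.norm_eq_abs] at hB
  -- The bound 1 serves to compare powers and T/2 to separate the two modified layers; t₀/2 keeps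
  -- the freezing inside the singular zone, and T - t₀ keeps the cut-off inside the `H¹` zone.
  set δ₀ := min (min 1 (T / 2)) (min (t₀ / 2) (T - t₀)) with hδ₀
  have h1 : δ₀ ≤ 1 := (min_le_left _ _).trans (min_le_left _ _)
  have h2 : δ₀ ≤ T / 2 := (min_le_left _ _).trans (min_le_right _ _)
  have h3 : δ₀ ≤ t₀ / 2 := (min_le_right _ _).trans (min_le_left _ _)
  have h4 : δ₀ ≤ T - t₀ := (min_le_right _ _).trans (min_le_right _ _)
  have h0 : 0 < δ₀ := lt_min (lt_min one_pos (by linarith))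
    (lt_min (by linarith [ht₀.1]) (by linarith [ht₀.2]))
  have hD0 : 0 ≤ ∫ t in t₀..T, deriv G t ^ 2 :=
    intervalIntegral.integral_nonneg ht₀.2.le fun s _ => sq_nonneg _
  have hbd' : ∀ᵐ t, t ∈ Ioo 0 t₀ → |deriv G t| ≤ C₀ * t ^ (-α - 1) :=
    (ae_restrict_iff' measurableSet_Ioo).1 hbd
  have hne : ∀ᵐ t : ℝ, t ≠ t₀ := by simp [ae_iff, measure_singleton]
  -- The derivative away from the singularity.
  have hd1 : ∀ δ : ℝ, 0 < δ → MemLp (deriv G) 2 (volume.restrict (Icc δ t₀)) := by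
    intro δ hδ
    refine MemLp.of_bound (measurable_deriv G).aestronglyMeasurable (C₀ * δ ^ (-α - 1)) ?_
    rw [ae_restrict_iff' measurableSet_Icc]
    filter_upwards [hbd', hne] with t ht htne htm
    refine (ht ⟨hδ.trans_le htm.1, lt_of_le_of_ne htm.2 htne⟩).trans ?_
    exact mul_le_mul_of_nonneg_left
      (Real.rpow_le_rpow_of_nonpos hδ htm.1 (by linarith)) hC₀.le
  have hd2 : ∀ δ : ℝ, 0 < δ → δ ≤ δ₀ → MemLp (deriv G) 2 (volume.restrict (Icc δ T)) := by
    intro δ hδ hδ'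
    rw [memLp_two_iff_integrable_sq (measurable_deriv G).aestronglyMeasurable]
    have e : Icc δ T = Icc δ t₀ ∪ Icc t₀ T :=
      (Icc_union_Icc_eq_Icc (by linarith) ht₀.2.le).symm
    rw [e]
    exact IntegrableOn.union (hd1 δ hδ).integrable_sq hH.2.integrable_sq
  have hftc1 : ∀ a b : ℝ, 0 < a → a ≤ b → b ≤ t₀ → ∫ s in a..b, deriv G s = G b - G a := by
    intro a b ha hab hb
    rcases hab.eq_or_lt with rfl | hab'
    · simp
    · refine ((hac a ⟨ha, hab'.trans_le hb⟩).mono ?_).integral_deriv_eq_sub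
      rw [uIcc_of_le hab, uIcc_of_le (hab.trans hb)]
      exact Icc_subset_Icc le_rfl hb
  have hftc : ∀ t ∈ Ioc 0 T, ∫ s in t..T, deriv G s = G T - G t := by
    intro t ht
    rcases le_total t t₀ with hle | hle
    · rw [← intervalIntegral.integral_add_adjacent_intervals
        (memLp_intervalIntegrable hle (hd1 t ht.1)) (memLp_intervalIntegrable ht₀.2.le hH.2),
        hftc1 t t₀ ht.1 hle le_rfl, integral_deriv_of_memH1 ht₀.2.le hH ⟨le_rfl, ht₀.2.le⟩]
      ring
    · exact integral_deriv_of_memH1 ht₀.2.le hH ⟨hle, ht.2⟩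
  -- The oscillation near the singularity.
  have hosc : ∀ δ : ℝ, δ ≤ δ₀ → ∀ t : ℝ, 0 < t → t ≤ δ → |G t - G δ| ≤ C₀ / α * t ^ (-α) := by
    intro δ hδ' t ht htδ
    have hδ : 0 < δ := ht.trans_le htδ
    have hnot : (0 : ℝ) ∉ uIcc t δ := by
      rw [uIcc_of_le htδ]; exact fun hm => not_le.2 ht hm.1
    rw [abs_sub_comm, ← hftc1 t δ ht htδ (by linarith [ht₀.1]), ← Real.norm_eq_abs]
    have hintg : IntervalIntegrable (fun s : ℝ => C₀ * s ^ (-α - 1)) volume t δ :=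
      (intervalIntegral.intervalIntegrable_rpow (Or.inr hnot)).const_mul _
    refine (intervalIntegral.norm_integral_le_of_norm_le htδ ?_ hintg).trans ?_
    · filter_upwards [hbd'] with s hs hsm
      exact hs ⟨ht.trans hsm.1, by linarith [hsm.2, ht₀.1]⟩
    · rw [intervalIntegral.integral_const_mul, integral_rpow (Or.inr ⟨by linarith, hnot⟩)]
      have e : -α - 1 + 1 = -α := by ring
      rw [e, div_mul_eq_mul_div, mul_div_assoc]
      refine mul_le_mul_of_nonneg_left ?_ hC₀.le
      rw [div_neg, ← neg_div, neg_sub]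
      exact div_le_div_of_nonneg_right (by linarith [Real.rpow_nonneg hδ.le (-α)]) hα0.le
  refine hasSourceRate_of_bounds hT.le hα0.le hα.2 hG (B := B)
    (X := (C₀ / α) ^ 2 / (1 - 2 * α)) (Y := C₀ ^ 2 / (1 + 2 * α) + ∫ t in t₀..T, deriv G t ^ 2)
    (div_nonneg (sq_nonneg _) (by linarith [hα.2])) (by positivity) h0 h1 (by linarith)
    (fun t ht => hB t ⟨by linarith [ht.1], ht.2⟩) hd2 hftc ?_ ?_
  · intro δ hδ hδ'
    have hδT : δ ≤ T := by linarith
    have hintg : IntervalIntegrable (fun t : ℝ => (C₀ / α) ^ 2 * t ^ (-2 * α)) volume 0 δ :=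
      (intervalIntegral.intervalIntegrable_rpow' (by linarith [hα.2])).const_mul _
    calc ∫ t in (0 : ℝ)..δ, (G t - G δ) ^ 2
        ≤ ∫ t in (0 : ℝ)..δ, (C₀ / α) ^ 2 * t ^ (-2 * α) := by
          refine intervalIntegral.integral_mono_on_of_le_Ioo hδ.le
            (memLp_intervalIntegrable_sq hδ.le
              ((memLp_mono_Icc hG le_rfl hδT).sub (continuousOn_memLp continuousOn_const)))
            hintg fun t ht => ?_
          have e := hosc δ hδ' t ht.1 ht.2.le
          refine (sq_le_sq' (abs_le.1 e).1 (abs_le.1 e).2).trans_eq ?_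
          rw [mul_pow, ← Real.rpow_natCast (t ^ (-α)), ← Real.rpow_mul ht.1.le]
          congr 2
          push_cast
          ring
      _ = (C₀ / α) ^ 2 / (1 - 2 * α) * δ ^ (1 - 2 * α) := by
          rw [intervalIntegral.integral_const_mul,
            integral_rpow (Or.inl (by linarith [hα.2])), show -2 * α + 1 = 1 - 2 * α by ring,
            Real.zero_rpow (by linarith [hα.2]), sub_zero]
          ring
  · intro δ hδ hδ'
    have hδt : δ ≤ t₀ := by linarith [ht₀.1]
    have hnot : (0 : ℝ) ∉ uIcc δ t₀ := by
      rw [uIcc_of_le hδt]; exact fun hm => not_le.2 hδ hm.1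
    have hintg : IntervalIntegrable (fun t : ℝ => C₀ ^ 2 * t ^ (-2 * α - 2)) volume δ t₀ :=
      (intervalIntegral.intervalIntegrable_rpow (Or.inr hnot)).const_mul _
    rw [← intervalIntegral.integral_add_adjacent_intervals
      (memLp_intervalIntegrable_sq hδt (hd1 δ hδ)) (memLp_intervalIntegrable_sq ht₀.2.le hH.2),
      add_mul]
    refine add_le_add ?_ (le_mul_of_one_le_right hD0
      (one_le_rpow_neg hδ (hδ'.trans h1) (by linarith)))
    calc ∫ t in δ..t₀, deriv G t ^ 2 ≤ ∫ t in δ..t₀, C₀ ^ 2 * t ^ (-2 * α - 2) := by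
          refine intervalIntegral.integral_mono_ae_restrict hδt
            (memLp_intervalIntegrable_sq hδt (hd1 δ hδ)) hintg ?_
          rw [Filter.EventuallyLE, ae_restrict_iff' measurableSet_Icc]
          filter_upwards [hbd', hne] with t ht htne htm
          have htp : 0 < t := hδ.trans_le htm.1
          have e := ht ⟨htp, lt_of_le_of_ne htm.2 htne⟩
          refine (sq_le_sq' (abs_le.1 e).1 (abs_le.1 e).2).trans_eq ?_
          rw [mul_pow, ← Real.rpow_natCast (t ^ (-α - 1)), ← Real.rpow_mul htp.le]
          congr 2
          push_cast
          ring
      _ = C₀ ^ 2 * ((δ ^ (-1 - 2 * α) - t₀ ^ (-1 - 2 * α)) / (1 + 2 * α)) := by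
          rw [intervalIntegral.integral_const_mul,
            integral_rpow (Or.inr ⟨by linarith, hnot⟩),
            show -2 * α - 2 + 1 = -1 - 2 * α by ring, show -1 - 2 * α = -(1 + 2 * α) by ring,
            div_neg, ← neg_div, neg_sub]
      _ ≤ C₀ ^ 2 * (δ ^ (-1 - 2 * α) / (1 + 2 * α)) := by
          gcongr
          linarith [Real.rpow_nonneg ht₀.1.le (-1 - 2 * α)]
      _ = C₀ ^ 2 / (1 + 2 * α) * δ ^ (-1 - 2 * α) := by ring

/-! ### The estimators along given paths of the noise -/

/-- At time 0 the convolution vanishes, so S - A reduces to the initial noise minus λ u(0). -/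
theorem lambdaLSE_sub {u G : ℝ → ℝ} (hu0 : u 0 ≠ 0) (lam : ℝ) (a n : ℕ → ℝ → ℝ) {N : ℕ}
    (hN : 1 ≤ N) :
    lambdaLSE u (fun m => observedPrice lam G u (a m) (n m)) a N - lam
      = -((1 / (N : ℝ)) * ∑ m ∈ Finset.range N, n m 0) / u 0 := by
  have hN' : (N : ℝ) ≠ 0 := by positivity
  have h : ∀ m, observedPrice lam G u (a m) (n m) 0 - a m 0 = n m 0 - lam * u 0 := by
    intro m
    simp only [observedPrice, intervalIntegral.integral_same]
    ring
  simp only [lambdaLSE, h, Finset.sum_sub_distrib, Finset.sum_const, Finset.card_range,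
    nsmul_eq_mul]
  field_simp
  ring

theorem abs_lambdaLSE_sub {u G : ℝ → ℝ} (hu0 : u 0 ≠ 0) (lam : ℝ) (a n : ℕ → ℝ → ℝ) {N : ℕ}
    (hN : 1 ≤ N) :
    |lambdaLSE u (fun m => observedPrice lam G u (a m) (n m)) a N - lam|
      = |(1 / (N : ℝ)) * ∑ m ∈ Finset.range N, n m 0| / |u 0| := by
  rw [lambdaLSE_sub hu0 lam a n hN, abs_div, abs_neg]

/-- The data of the least-squares problem in `L²([0,T])`. -/
def residual {T : ℝ} (hT : 0 ≤ T) {u G : ℝ → ℝ} (hu : ContinuousOn u (Icc 0 T))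
    (hG : MemLp G 2 (volume.restrict (Icc 0 T))) {n : ℕ → ℝ → ℝ}
    (hn : ∀ m, MemLp (n m) 2 (volume.restrict (Icc 0 T))) (δ : ℝ) (m : ℕ) : LTwo T :=
  (hn m).toLp (n m) + δ • (continuousOn_memLp hu).toLp u - volterraLp hT hu (hG.toLp G)

/-- Inserting the price model cancels the signal and, as convolution is commutative, leaves noise +
(λ^N - λ) u - K G + K f. -/
theorem lseLoss_eq_ridge {T : ℝ} (hT : 0 ≤ T) {u G : ℝ → ℝ} (hu : ContinuousOn u (Icc 0 T))
    (hG : MemLp G 2 (volume.restrict (Icc 0 T))) (lam : ℝ) (a : ℕ → ℝ → ℝ) {n : ℕ → ℝ → ℝ}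
    (hn : ∀ m, MemLp (n m) 2 (volume.restrict (Icc 0 T))) (N : ℕ) (τ : ℝ) {f : ℝ → ℝ}
    (hf : MemLp f 2 (volume.restrict (Icc 0 T))) :
    lseLoss T u (fun m => observedPrice lam G u (a m) (n m)) a N τ f
      = ridge (volterraLp hT hu) (residual hT hu hG hn
          (lambdaLSE u (fun m => observedPrice lam G u (a m) (n m)) a N - lam)) N τ
        (hf.toLp f) := by
  set δ := lambdaLSE u (fun m => observedPrice lam G u (a m) (n m)) a N - lam with hδ
  unfold lseLoss ridge
  rw [l2norm_eq_norm_toLp hf]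
  congr 2
  refine Finset.sum_congr rfl fun m _ => ?_
  have huL : MemLp u 2 (volume.restrict (Icc 0 T)) := continuousOn_memLp hu
  have hmem := (((hn m).add (huL.const_smul δ)).sub (volterra_memLp hT hu hG)).add
    (volterra_memLp hT hu hf)
  rw [residual, volterraLp_toLp, volterraLp_toLp, ← MemLp.toLp_const_smul, ← MemLp.toLp_add,
    ← MemLp.toLp_sub, ← MemLp.toLp_add, ← l2norm_eq_norm_toLp hmem]
  congr 1
  refine l2norm_congr fun t _ => ?_
  simp only [observedPrice, integral_comm_volterra, Pi.add_apply, Pi.sub_apply, Pi.smul_apply,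
    smul_eq_mul, hδ]
  ring

theorem exists_isKernelLSE {T : ℝ} (hT : 0 ≤ T) {u G : ℝ → ℝ} (hu : ContinuousOn u (Icc 0 T))
    (hG : MemLp G 2 (volume.restrict (Icc 0 T))) (lam : ℝ) (a : ℕ → ℝ → ℝ) {n : ℕ → ℝ → ℝ}
    (hn : ∀ m, MemLp (n m) 2 (volume.restrict (Icc 0 T))) {N : ℕ} {τ : ℝ} (hτ : 0 < τ)
    {π : Fin (N + 1) → ℝ} (hπ : StrictMono π) :
    ∃ GN, IsKernelLSE T u (fun m => observedPrice lam G u (a m) (n m)) a τ π GN := by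
  obtain ⟨g, hgV, hg⟩ := exists_isMinOn_ridge (volterraLp hT hu) (residual hT hu hG hn
    (lambdaLSE u (fun m => observedPrice lam G u (a m) (n m)) a N - lam)) N hτ (stepSpace T π)
  obtain ⟨f, hf, rfl⟩ := exists_piecewiseConst_of_mem_stepSpace hπ hgV
  refine ⟨f, hf, fun f' hf' => ?_⟩
  simp only [mem_ofPred_eq]
  rw [lseLoss_eq_ridge hT hu hG lam a hn N τ (memLp_of_mem_piecewiseConst hf),
    lseLoss_eq_ridge hT hu hG lam a hn N τ (memLp_of_mem_piecewiseConst hf')]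
  exact hg (toLp_mem_stepSpace hf')

theorem isMinOn_ridge_of_isKernelLSE {T : ℝ} (hT : 0 ≤ T) {u G : ℝ → ℝ}
    (hu : ContinuousOn u (Icc 0 T)) (hG : MemLp G 2 (volume.restrict (Icc 0 T))) {lam : ℝ}
    {a n : ℕ → ℝ → ℝ} (hn : ∀ m, MemLp (n m) 2 (volume.restrict (Icc 0 T))) {N : ℕ} {τ : ℝ}
    {π : Fin (N + 1) → ℝ} (hπ : StrictMono π) {GN : ℝ → ℝ}
    (h : IsKernelLSE T u (fun m => observedPrice lam G u (a m) (n m)) a τ π GN) :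
    IsMinOn (ridge (volterraLp hT hu) (residual hT hu hG hn
      (lambdaLSE u (fun m => observedPrice lam G u (a m) (n m)) a N - lam)) N τ) (stepSpace T π)
      ((memLp_of_mem_piecewiseConst h.1).toLp GN) := by
  intro F hF
  obtain ⟨f, hf, rfl⟩ := exists_piecewiseConst_of_mem_stepSpace hπ hF
  have := h.2 hf
  simp only [mem_ofPred_eq] at this ⊢
  rwa [lseLoss_eq_ridge hT hu hG lam a hn N τ (memLp_of_mem_piecewiseConst h.1),
    lseLoss_eq_ridge hT hu hG lam a hn N τ (memLp_of_mem_piecewiseConst hf)] at this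

/-- The error of the kernel estimator in terms of the empirical mean of the noise. -/
theorem exists_kernelLSE_error_le {T : ℝ} (hT : 0 ≤ T) {u G : ℝ → ℝ} (hu : MemH1 0 T u)
    (hu0 : u 0 ≠ 0) (hG : MemLp G 2 (volume.restrict (Icc 0 T))) {α : ℝ}
    (hrate : HasSourceRate hT α (hG.toLp G)) (C : ℝ) (hC : 0 ≤ C) :
    ∃ D : ℝ, 0 ≤ D ∧ ∀ (lam : ℝ) (a n : ℕ → ℝ → ℝ),
      (∀ m, MemLp (n m) 2 (volume.restrict (Icc 0 T))) → ∀ (N : ℕ), 1 ≤ N → ∀ (τ : ℝ), 0 < τ →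
      ∀ (π : Fin (N + 1) → ℝ), IsPartition T π → mesh π ≤ C * √τ → ∀ GN : ℝ → ℝ,
        IsKernelLSE T u (fun m => observedPrice lam G u (a m) (n m)) a τ π GN →
        l2norm T (fun t => GN t - G t) ≤ D * (√τ ^ (1 / 2 - α)
          + (|(1 / (N : ℝ)) * ∑ m ∈ Finset.range N, n m 0|
            + l2norm T (fun t => (1 / (N : ℝ)) * ∑ m ∈ Finset.range N, n m t)) / √τ) := by
  have huc := memH1_continuousOn hT hu
  obtain ⟨c, hc, hJK, hKJ⟩ := exists_norm_equiv hT hu hu0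
  obtain ⟨B, hB, hsrc⟩ := hrate
  have huL : MemLp u 2 (volume.restrict (Icc 0 T)) := continuousOn_memLp huc
  set U := ‖huL.toLp u‖ / |u 0| with hU
  have hU0 : 0 ≤ U := by positivity
  -- Sum of the coefficients of `d` and √τ R in the Galerkin bound once `mesh π` is replaced by C
  -- √τ.
  set L := c * C + 2 + c * C ^ 2 + c + C with hL
  have hL0 : 0 ≤ L := by positivity
  refine ⟨L * B + (1 + U), by positivity, ?_⟩
  intro lam a n hn N hN τ hτ π hπ hmesh GN hGN
  set e₀ := |(1 / (N : ℝ)) * ∑ m ∈ Finset.range N, n m 0| with he₀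
  set e₁ := l2norm T (fun t => (1 / (N : ℝ)) * ∑ m ∈ Finset.range N, n m t) with he₁
  have he₀0 : 0 ≤ e₀ := abs_nonneg _
  have he₁0 : 0 ≤ e₁ := ENNReal.toReal_nonneg
  have hs : 0 < √τ := Real.sqrt_pos.2 hτ
  have hss : √τ * √τ = τ := Real.mul_self_sqrt hτ.le
  set δ := lambdaLSE u (fun m => observedPrice lam G u (a m) (n m)) a N - lam with hδ
  have hδabs : |δ| = e₀ / |u 0| := abs_lambdaLSE_sub hu0 lam a n hN
  -- The scale σ = √τ is the one at which the bound contains exactly the combination d + √τ R.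
  obtain ⟨h, R, hR, hdual, hdR⟩ := hsrc (√τ) hs
  set ε : LTwo T := (1 / (N : ℝ)) • ∑ m ∈ Finset.range N, (hn m).toLp (n m)
    + δ • huL.toLp u with hε
  have hmean : ‖(1 / (N : ℝ)) • ∑ m ∈ Finset.range N, (hn m).toLp (n m)‖ = e₁ := by
    have hmem : MemLp (fun t => (1 / (N : ℝ)) * ∑ m ∈ Finset.range N, n m t) 2
        (volume.restrict (Icc 0 T)) :=
      (memLp_finsetSum (Finset.range N) fun m _ => hn m).const_mul _
    rw [he₁, l2norm_eq_norm_toLp hmem]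
    congr 1
    refine Lp.ext ?_
    filter_upwards [hmem.coeFn_toLp,
      Lp.coeFn_smul (1 / (N : ℝ)) (∑ m ∈ Finset.range N, (hn m).toLp (n m)),
      Lp.coeFn_finsetSum (Finset.range N) fun m => (hn m).toLp (n m),
      ae_all_iff.2 fun m => (hn m).coeFn_toLp] with t h1 h2 h3 h4
    rw [h1, h2, Pi.smul_apply, h3, Finset.sum_apply, smul_eq_mul]
    simp only [h4]
  have hεnorm : ‖ε‖ ≤ (1 + U) * (e₀ + e₁) := by
    have h1 : ‖δ • huL.toLp u‖ = e₀ * U := by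
      rw [norm_smul, Real.norm_eq_abs, hδabs, hU]; ring
    have h2 := norm_add_le ((1 / (N : ℝ)) • ∑ m ∈ Finset.range N, (hn m).toLp (n m))
      (δ • huL.toLp u)
    rw [hmean, h1] at h2
    rw [hε]
    nlinarith [mul_nonneg hU0 he₁0]
  have hN' : (N : ℝ) ≠ 0 := by positivity
  -- The normal equation sees the data only through their mean, which is the effective noise `ε`
  -- minus the image of the true kernel.
  have hxbar : (1 / (N : ℝ)) • ∑ m ∈ Finset.range N, residual hT huc hG hn δ m
      = ε - volterraLp hT huc (hG.toLp G) := by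
    simp only [residual, hε, Finset.sum_sub_distrib, Finset.sum_add_distrib, Finset.sum_const,
      Finset.card_range, smul_sub, smul_add, ← Nat.cast_smul_eq_nsmul ℝ, smul_smul,
      one_div_mul_cancel hN', one_smul]
    rw [← mul_assoc, one_div_mul_cancel hN', one_mul]
  have hmin := isMinOn_ridge_of_isKernelLSE hT huc hG hn hπ.1 hGN
  have hgV := toLp_mem_stepSpace hGN.1
  have hmain := galerkin_error_le (μ := mesh π) (ε := ε) (G := hG.toLp G) (τ := τ)
    hc (mesh_nonneg hπ.1) hτ hR hJK hKJ
    (fun F hF => norm_primitiveLp_le_mesh hT hπ hF) hgV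
    (fun v hv => by rw [← hxbar]; exact normal_equation hN hgV hmin hv) hdual
  have hGNL := memLp_of_mem_piecewiseConst hGN.1
  have hl2 : l2norm T (fun t => GN t - G t) = ‖hGNL.toLp GN - hG.toLp G‖ := by
    rw [← MemLp.toLp_sub, ← l2norm_eq_norm_toLp (hGNL.sub hG)]
    rfl
  rw [hl2]
  refine hmain.trans ?_
  set d := ‖hG.toLp G - h‖ with hd
  have hd0 : 0 ≤ d := norm_nonneg _
  have hm0 := mesh_nonneg hπ.1
  have hsR : 0 ≤ √τ * R := by positivity
  have hmR : mesh π * R ≤ C * (√τ * R) := by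
    rw [← mul_assoc]; exact mul_le_mul_of_nonneg_right hmesh hR
  have hA : (c * mesh π * (d + mesh π * R) + ‖ε‖ + τ * (R * c)) / √τ
      ≤ c * C * (d + C * (√τ * R)) + ‖ε‖ / √τ + c * (√τ * R) := by
    rw [add_div, add_div]
    refine add_le_add (add_le_add ?_ le_rfl) (le_of_eq ?_)
    · rw [div_le_iff₀ hs]
      calc c * mesh π * (d + mesh π * R)
          ≤ c * (C * √τ) * (d + C * (√τ * R)) := by gcongr
        _ = c * C * (d + C * (√τ * R)) * √τ := by ring
    · rw [div_eq_iff hs.ne']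
      nth_rewrite 1 [← hss]
      ring
  have hE : ‖ε‖ / √τ ≤ (1 + U) * ((e₀ + e₁) / √τ) := by
    rw [← mul_div_assoc]; exact div_le_div_of_nonneg_right hεnorm hs.le
  have hLd : L * (d + √τ * R) ≤ L * (B * √τ ^ (1 / 2 - α)) := mul_le_mul_of_nonneg_left hdR hL0
  have hpow : 0 ≤ √τ ^ (1 / 2 - α) := by positivity
  have hq : 0 ≤ (e₀ + e₁) / √τ := by positivity
  have hx1 : 0 ≤ (1 + U) * √τ ^ (1 / 2 - α) := by positivity
  have hx2 : 0 ≤ L * B * ((e₀ + e₁) / √τ) := by positivity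
  have hx3 : c * C * (d + C * (√τ * R)) + c * (√τ * R) + d + (d + C * (√τ * R))
      ≤ L * (d + √τ * R) := by
    rw [hL]
    nlinarith [mul_nonneg hc hd0, mul_nonneg hC hd0, mul_nonneg hc hsR, mul_nonneg hC hsR,
      mul_nonneg (mul_nonneg hc (sq_nonneg C)) hd0, mul_nonneg (mul_nonneg hc hC) hsR]
  linarith

/-! ### The high-probability event -/

theorem rate_pos {η : ℝ} (hη : η ∈ Ioo (0 : ℝ) 1) {N : ℕ} (hN : 2 ≤ N) : 0 < rate η N := by
  have h1 : 0 < Real.log η⁻¹ := Real.log_pos ((one_lt_inv₀ hη.1).2 hη.2)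
  have h2 : 0 ≤ Real.log N := Real.log_natCast_nonneg N
  have h3 : (0 : ℝ) < N := by positivity
  unfold rate
  positivity

/-- Failure budget of the union bound, with N = k + 2: the partial sums telescope to η - η/(K + 1).
-/
theorem tsum_ofReal_telescope_le {η : ℝ} (hη : 0 ≤ η) :
    ∑' k : ℕ, ENNReal.ofReal (η / (((k : ℝ) + 1) * ((k : ℝ) + 2))) ≤ ENNReal.ofReal η := by
  refine ENNReal.tsum_le_of_sum_range_le fun K => ?_
  rw [← ENNReal.ofReal_sum_of_nonneg fun k _ => by positivity]
  refine ENNReal.ofReal_le_ofReal ?_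
  have h : ∑ k ∈ Finset.range K, η / (((k : ℝ) + 1) * ((k : ℝ) + 2)) = η - η / ((K : ℝ) + 1) := by
    induction K with
    | zero => simp
    | succ K ih =>
      rw [Finset.sum_range_succ, ih]
      push_cast
      field_simp
      ring
  rw [h]
  have : 0 ≤ η / ((K : ℝ) + 1) := by positivity
  linarith

/-- Since 2(k + 1) ≤ (k + 2)², the argument of the logarithm is at most (k + 2)³/η. The factor 3 is
needed only on log(k + 2), and is harmless on log η⁻¹ > 0. -/
theorem log_two_div_le {η : ℝ} (hη : η ∈ Ioo (0 : ℝ) 1) (k : ℕ) :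
    Real.log (2 * (η / (((k : ℝ) + 1) * ((k : ℝ) + 2)))⁻¹)
      ≤ 3 * (Real.log η⁻¹ + Real.log ((k + 2 : ℕ) : ℝ)) := by
  have hη0 := hη.1
  have h1 : 0 < Real.log η⁻¹ := Real.log_pos ((one_lt_inv₀ hη.1).2 hη.2)
  have hk : (0 : ℝ) ≤ k := Nat.cast_nonneg k
  have e : 2 * (η / (((k : ℝ) + 1) * ((k : ℝ) + 2)))⁻¹
      = 2 * ((k : ℝ) + 1) * ((k : ℝ) + 2) * η⁻¹ := by
    field_simp
  have h2 : 2 * ((k : ℝ) + 1) * ((k : ℝ) + 2) * η⁻¹ ≤ ((k : ℝ) + 2) ^ 3 * η⁻¹ := by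
    refine mul_le_mul_of_nonneg_right ?_ (by positivity)
    nlinarith [mul_nonneg hk hk, mul_nonneg (mul_nonneg hk hk) hk]
  have h3 := Real.log_le_log (by positivity) h2
  rw [e]
  rw [Real.log_mul (x := ((k : ℝ) + 2) ^ 3) (by positivity) (by positivity), Real.log_pow] at h3
  push_cast at h3 ⊢
  linarith

/-- With probability at least `1 - η` the paths of the noise are square integrable and all their
empirical means are bounded by the rate. -/
theorem exists_noise_event {Ω : Type*} [MeasurableSpace Ω] {T : ℝ} {P : Measure Ω}
    [IsProbabilityMeasure P] {M : ℕ → ℝ → Ω → ℝ}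
    (hmem : ∀ m, ∀ᵐ ω ∂P, MemLp (fun t => M m t ω) 2 (volume.restrict (Icc 0 T)))
    (hM : NoiseConcentration T P M) :
    ∃ c : ℝ, 0 < c ∧ ∀ η ∈ Ioo (0 : ℝ) 1, ∃ E : Set Ω, MeasurableSet E ∧ 1 - η ≤ P.real E ∧
      ∀ ω ∈ E, (∀ m, MemLp (fun t => M m t ω) 2 (volume.restrict (Icc 0 T))) ∧
        ∀ N : ℕ, 2 ≤ N → |(1 / (N : ℝ)) * ∑ m ∈ Finset.range N, M m 0 ω| +
          l2norm T (fun t => (1 / (N : ℝ)) * ∑ m ∈ Finset.range N, M m t ω) ≤ c * rate η N := by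
  obtain ⟨CM, hCM, hconc⟩ := hM
  refine ⟨3 * CM, by positivity, fun η hη => ?_⟩
  have hη0 := hη.1
  set η' : ℕ → ℝ := fun k => η / (((k : ℝ) + 1) * ((k : ℝ) + 2)) with hη'
  set bad : ℕ → Set Ω := fun k =>
    {ω | CM * Real.log (2 * (η' k)⁻¹) * ((k + 2 : ℕ) : ℝ) ^ (-(1 / 2) : ℝ) ≤
      |(1 / ((k + 2 : ℕ) : ℝ)) * ∑ m ∈ Finset.range (k + 2), M m 0 ω| +
        l2norm T (fun t => (1 / ((k + 2 : ℕ) : ℝ)) * ∑ m ∈ Finset.range (k + 2), M m t ω)}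
    with hbad
  set Z : Set Ω := {ω | ¬ ∀ m, MemLp (fun t => M m t ω) 2 (volume.restrict (Icc 0 T))} with hZ
  have hZ0 : P Z = 0 := ae_iff.1 (ae_all_iff.2 hmem)
  have hbadle : ∀ k, P (bad k) ≤ ENNReal.ofReal (η' k) := by
    intro k
    have h := hconc (k + 2) (by omega) (η' k) (by positivity)
    rw [← ofReal_measureReal]
    exact ENNReal.ofReal_le_ofReal h
  have hP : P (Z ∪ ⋃ k, bad k) ≤ ENNReal.ofReal η := by
    refine (measure_union_le _ _).trans ?_
    rw [hZ0, zero_add]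
    exact (measure_iUnion_le _).trans ((ENNReal.tsum_le_tsum hbadle).trans
      (tsum_ofReal_telescope_le hη0.le))
  -- The bad sets involve `L²` norms of paths and need not be measurable, so a measurable hull of
  -- the same measure is removed.
  refine ⟨(toMeasurable P (Z ∪ ⋃ k, bad k))ᶜ, (measurableSet_toMeasurable _ _).compl, ?_, ?_⟩
  · rw [probReal_compl_eq_one_sub (measurableSet_toMeasurable _ _), measureReal_def,
      measure_toMeasurable]
    have := ENNReal.toReal_le_of_le_ofReal hη0.le hP
    linarith
  · intro ω hω
    have hω' : ω ∉ Z ∪ ⋃ k, bad k := fun h => hω (subset_toMeasurable P _ h)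
    rw [mem_union, not_or, mem_iUnion, not_exists] at hω'
    refine ⟨by simpa [hZ] using hω'.1, fun N hN => ?_⟩
    obtain ⟨k, rfl⟩ : ∃ k, N = k + 2 := ⟨N - 2, by omega⟩
    have h1 := hω'.2 k
    simp only [hbad, mem_ofPred_eq, not_le] at h1
    refine h1.le.trans ?_
    have h2 := log_two_div_le hη k
    have h3 : ((k + 2 : ℕ) : ℝ) ^ (-(1 / 2) : ℝ) = (√((k + 2 : ℕ) : ℝ))⁻¹ := by
      rw [Real.rpow_neg (Nat.cast_nonneg _), ← Real.sqrt_eq_rpow]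
    rw [h3, rate, ← div_eq_mul_inv, mul_div_assoc']
    refine div_le_div_of_nonneg_right ?_ (Real.sqrt_nonneg _)
    calc CM * Real.log (2 * (η' k)⁻¹)
        ≤ CM * (3 * (Real.log η⁻¹ + Real.log ((k + 2 : ℕ) : ℝ))) :=
          mul_le_mul_of_nonneg_left h2 hCM.le
      _ = 3 * CM * (Real.log η⁻¹ + Real.log ((k + 2 : ℕ) : ℝ)) := by ring

/-- The bias and the variance are balanced by the tuning `τ ≍ r ^ (4 / (3 - 2α))`. -/
theorem balanced_rate_le {α C r τ e c : ℝ} (hα : α < 1 / 2) (hC : 1 ≤ C) (hr : 0 < r)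
    (hτ₁ : (1 / C) * r ^ (4 / (3 - 2 * α)) ≤ τ) (hτ₂ : τ ≤ C * r ^ (4 / (3 - 2 * α)))
    (hc : 0 ≤ c) (he : e ≤ c * r) :
    √τ ^ (1 / 2 - α) + e / √τ
      ≤ (√C ^ (1 / 2 - α) + c * √C) * r ^ ((1 - 2 * α) / (3 - 2 * α)) := by
  have hC0 : 0 < C := by linarith
  have h32 : 3 - 2 * α ≠ 0 := by linarith
  have hrp : 0 < r ^ (4 / (3 - 2 * α)) := Real.rpow_pos_of_pos hr _
  have hτ : 0 < τ := lt_of_lt_of_le (by positivity) hτ₁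
  -- Thus √τ is comparable to r^(2/(3 - 2α)). Bias and noise then have the same exponent, since
  -- (2/(3 - 2α)) (1/2 - α) = 1 - 2/(3 - 2α) = (1 - 2α)/(3 - 2α).
  have hsqrt : √(r ^ (4 / (3 - 2 * α))) = r ^ (2 / (3 - 2 * α)) := by
    rw [Real.sqrt_eq_rpow, ← Real.rpow_mul hr.le]
    congr 1
    ring
  have hup : √τ ≤ √C * r ^ (2 / (3 - 2 * α)) := by
    rw [← hsqrt, ← Real.sqrt_mul hC0.le]
    exact Real.sqrt_le_sqrt hτ₂
  have hlow : r ^ (2 / (3 - 2 * α)) ≤ √C * √τ := by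
    rw [← hsqrt, ← Real.sqrt_mul hC0.le]
    refine Real.sqrt_le_sqrt ?_
    rw [one_div, inv_mul_le_iff₀ hC0] at hτ₁
    exact hτ₁
  rw [add_mul]
  refine add_le_add ?_ ?_
  · refine (Real.rpow_le_rpow (Real.sqrt_nonneg _) hup (by linarith)).trans_eq ?_
    rw [Real.mul_rpow (Real.sqrt_nonneg _) (by positivity), ← Real.rpow_mul hr.le]
    congr 2
    field_simp
  · rw [div_le_iff₀ (Real.sqrt_pos.2 hτ)]
    have hsplit : r = r ^ ((1 - 2 * α) / (3 - 2 * α)) * r ^ (2 / (3 - 2 * α)) := by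
      rw [← Real.rpow_add hr, ← add_div, show 1 - 2 * α + 2 = 3 - 2 * α by ring, div_self h32,
        Real.rpow_one]
    calc e ≤ c * r := he
      _ = c * (r ^ ((1 - 2 * α) / (3 - 2 * α)) * r ^ (2 / (3 - 2 * α))) := by rw [← hsplit]
      _ ≤ c * (r ^ ((1 - 2 * α) / (3 - 2 * α)) * (√C * √τ)) := by gcongr
      _ = c * √C * r ^ ((1 - 2 * α) / (3 - 2 * α)) * √τ := by ring

/-- The high-probability bound for kernels with a source approximation rate. -/
theorem highProbabilityBound_of_hasSourceRate {Ω : Type*} [MeasurableSpace Ω] {T : ℝ}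
    (hT : 0 ≤ T) {P : Measure Ω} [IsProbabilityMeasure P] (A : ℕ → ℝ → Ω → ℝ)
    {M : ℕ → ℝ → Ω → ℝ}
    (hmem : ∀ m, ∀ᵐ ω ∂P, MemLp (fun t => M m t ω) 2 (volume.restrict (Icc 0 T)))
    (hM : NoiseConcentration T P M) (lam : ℝ) {u G : ℝ → ℝ} (hu : MemH1 0 T u) (hu0 : u 0 ≠ 0)
    (hG : MemLp G 2 (volume.restrict (Icc 0 T))) {α : ℝ} (hα : α < 1 / 2)
    (hrate : HasSourceRate hT α (hG.toLp G)) {C : ℝ} (hC : 1 ≤ C) :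
    HighProbabilityBound T P A M u lam G C (4 / (3 - 2 * α)) ((1 - 2 * α) / (3 - 2 * α)) := by
  obtain ⟨c, hc, hev⟩ := exists_noise_event hmem hM
  obtain ⟨D, hD, herr⟩ := exists_kernelLSE_error_le hT hu hu0 hG hrate C (by linarith)
  have hu0' : 0 < |u 0| := abs_pos.2 hu0
  set D' := D * (√C ^ (1 / 2 - α) + c * √C) with hD'
  have hD'0 : 0 ≤ D' := by positivity
  refine ⟨c / |u 0| + D', by positivity, fun η hη τ π htuned => ?_⟩
  obtain ⟨E, hE, hPE, hω⟩ := hev η hη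
  refine ⟨E, hE, hPE, fun ω hωE N hN => ?_⟩
  obtain ⟨hn, hmean⟩ := hω ω hωE
  obtain ⟨hτ₁, hτ₂, hπ, hmesh⟩ := htuned N hN
  have hr := rate_pos hη hN
  have hN1 : 1 ≤ N := by omega
  have hτ : 0 < τ N :=
    lt_of_lt_of_le (mul_pos (by positivity) (Real.rpow_pos_of_pos hr _)) hτ₁
  intro a S
  have hmeanN := hmean N hN
  refine ⟨?_, exists_isKernelLSE hT (memH1_continuousOn hT hu) hG lam a hn hτ hπ.1, ?_⟩
  · rw [abs_lambdaLSE_sub (G := G) hu0 lam a (fun m t => M m t ω) hN1]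
    have h1 : |(1 / (N : ℝ)) * ∑ m ∈ Finset.range N, M m 0 ω| ≤ c * rate η N :=
      le_trans (le_add_of_nonneg_right ENNReal.toReal_nonneg) hmeanN
    have h2 := div_le_div_of_nonneg_right h1 hu0'.le
    have h3 : 0 ≤ D' * rate η N := by positivity
    calc _ ≤ c * rate η N / |u 0| := h2
      _ = c / |u 0| * rate η N := by ring
      _ ≤ (c / |u 0| + D') * rate η N := by rw [add_mul]; linarith
  · intro GN hGN
    have h1 := herr lam a (fun m t => M m t ω) hn N hN1 (τ N) hτ (π N) hπ hmesh GN hGN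
    have h2 := balanced_rate_le hα hC hr hτ₁ hτ₂ hc.le hmeanN
    have h3 := mul_le_mul_of_nonneg_left h2 hD
    have h4 : 0 ≤ c / |u 0| * rate η N ^ ((1 - 2 * α) / (3 - 2 * α)) := by positivity
    calc _ ≤ _ := h1
      _ ≤ _ := h3
      _ = D' * rate η N ^ ((1 - 2 * α) / (3 - 2 * α)) := by rw [hD']; ring
      _ ≤ _ := by rw [add_mul]; linarith

end PropagatorEstimation

end

open PropagatorEstimation in
theorem mainTheorem1 {Ω₀ Ω : Type*} [MeasurableSpace Ω₀] [MeasurableSpace Ω]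
    (T : ℝ) (hT : 0 < T)
    (P₀ : Measure Ω₀) [IsProbabilityMeasure P₀]
    (ℱ : Filtration (Icc (0 : ℝ) T) ‹MeasurableSpace Ω₀›)
    (A₀ M₀ : ℝ → Ω₀ → ℝ) (hprice : IsUnaffectedPrice T P₀ ℱ A₀ M₀)
    (P : Measure Ω) [IsProbabilityMeasure P]
    (A M : ℕ → ℝ → Ω → ℝ) (hcopies : AreIndependentCopies T P₀ A₀ M₀ P A M)
    (lam : ℝ) (G : ℝ → ℝ) (hG : MemLp G 2 (volume.restrict (Icc 0 T)))
    (u : ℝ → ℝ) (hu : MemH1 0 T u) (hu0 : u 0 ≠ 0)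
    (hM : NoiseConcentration T P M)
    (C : ℝ) (hC : 1 ≤ C) :
    (IsRegularKernel T G →
      HighProbabilityBound T P A M u lam G C (4 / 3) (1 / 3)) ∧
    (∀ α ∈ Ioo (0 : ℝ) (1 / 2), IsSingularKernel T α G →
      HighProbabilityBound T P A M u lam G C (4 / (3 - 2 * α)) ((1 - 2 * α) / (3 - 2 * α))) := by
  refine ⟨fun h => ?_, fun α hα h => ?_⟩
  -- The regular case is α = 0, where the exponents become 4/3 and 1/3.
  · have hb := highProbabilityBound_of_hasSourceRate hT.le A hcopies.memLp_noise hM lam hu hu0 hG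
      (by norm_num) (hasSourceRate_regular hT hG h.1) hC
    simpa using hb
  · exact highProbabilityBound_of_hasSourceRate hT.le A hcopies.memLp_noise hM lam hu hu0 hG
      hα.2 (hasSourceRate_singular hT hα hG h) hC
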